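/- **Setting.** A binary classification task consists of a data set of $n$ points $x_1,\dots,x_n$ of a set $X$, with arbitrary fixed labels $y_1,\dots,y_n\in\{0,1\}$, and a nonempty class $H$ of classifiers $X\to\{0,1\}$ of finite VC dimension $V_H$. Let $S=\{1,\dots,n\}$; classifiers that agree on all data points are identified. For $S'\subseteq S$ put $\mathrm{err}_{S'}(h)=\frac1{|S'|}\#\{j\in S': h(x_j)\ne y_j\}$, and let $\eta=\min_{h\in H}\mathrm{err}_S(h)$ be the optimal error. Put $D(h,g)=\frac1n\#\{j: h(x_j)\neq g(x_j)\}$; for $A\subseteq H$ let $B_A(h,r)=\{g\in A: D(h,g)\le r\}$, $\mathrm{DIS}(A)=\{j\in S:\exists g,g'\in A,\ g(x_j)\ne g'(x_j)\}$ and $\mathrm{radius}(A)=\min\{r:\exists h\in A,\ A\subseteq B_A(h,r)\}$. The disagreement coefficient is $\theta=\sup_{h\in H}\sup_{r>0}\frac{|\mathrm{DIS}(B_H(h,r))|}{rn}$. For a real number $a$ and $D\subseteq S$, let $\mathcal R(a,D)$ be a uniformly random subset of $D$ of size $\min(\lceil a\rceil,|D|)$, each draw being independent of the previous ones. For a sample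 $S'$ and a width $w$ put $\mathrm{LB}_w(S',h)=\mathrm{err}_{S'}(h)-\frac w2$ and $\mathrm{UB}_w(S',h)=\mathrm{err}_{S'}(h)+\frac w2$. **Algorithm** (constants $c_1,c_2,b_1,b_2$; parameters $0<\epsilon\le1$, $0<\delta<1$; $\delta'=\delta/(2\log_2(2n))$). Start with $H_0=H$, $r_0=1$. For $i=0,1,2,\dots$, while $|H_i|>1$: 1. Draw $S_i=\mathcal R\big(c_1\theta^2(V_H\ln\theta+\ln\frac1{\delta'})+b_1,\ \mathrm{DIS}(H_i)\big)$. With $w=\frac1{16\theta}$ let $\beta=\min_{h\in H_i}\mathrm{UB}_w(S_i,h)$, $H_{i+1}=\{h\in H_i:\mathrm{LB}_w(S_i,h)\le\beta\}$ and $r_{i+1}=\mathrm{radius}(H_{i+1})$. 2. If $r_{i+1}>r_i/2$, draw $S'=\mathcal R\big(\frac{c_2\theta^2}{\epsilon^2}(V_H\ln\frac\theta\epsilon+\ln\frac1\delta)+b_2,\ \mathrm{DIS}(H_i)\big)$, return a minimizer over $h\in H_i$ of $\mathrm{UB}_{w'}(S',h)$ with $w'=\frac{\epsilon}{16\theta}$,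 and stop. When $|H_i|=1$, return the only classifier in $H_i$. **Theorem.** There are universal constants $c_1,c_2,b_1,b_2>0$ such that, for every binary classification task, all $0<\epsilon\le1$ and $0<\delta<1$, and every rule for breaking ties in the choice of the minimizer, with probability at least $1-\delta$ the algorithm stops after at most $\log_2(2n)$ iterations of its loop and returns a classifier $h\in H$ with $$\mathrm{err}_S(h)<\eta(1+\epsilon)\quad\text{if }\eta>0,\qquad \mathrm{err}_S(h)=0\quad\text{if }\eta=0.$$ -/

import Mathlib

open Finset

noncomputable section

namespace ActiveLearning

open scoped Classical

/-- A set `T` of points is shattered by `H` if every labelling of `T` is realised by `H`. -/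
def Shatters {X : Type*} (H : Set (X → Bool)) (T : Finset X) : Prop :=
  ∀ g : X → Bool, ∃ h ∈ H, ∀ t ∈ T, h t = g t

/-- The VC dimension of a class of binary classifiers. -/
def vcDim {X : Type*} (H : Set (X → Bool)) : ℕ∞ :=
  ⨆ (T : Finset X) (_ : Shatters H T), (#T : ℕ∞)

variable {n : ℕ}

/-- The classifiers of `H`, seen as classifiers of the data points `x 0, …, x (n - 1)`;
two classifiers that agree on the whole data set are identified. -/
def onData {X : Type*} (x : Fin n → X) (H : Set (X → Bool)) : Finset (Fin n → Bool) :=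
  {g | ∃ h ∈ H, h ∘ x = g}

/-- `err_S(h)`: the fraction of the points of `S` that `h` misclassifies. -/
def err (y : Fin n → Bool) (S : Finset (Fin n)) (h : Fin n → Bool) : ℝ :=
  (#{j ∈ S | h j ≠ y j} : ℝ) / #S

/-- The fraction of the whole data set on which two classifiers disagree. -/
def distance (h g : Fin n → Bool) : ℝ :=
  (#{j : Fin n | h j ≠ g j} : ℝ) / n

/-- The ball in `A` of radius `r` around `h`. -/
def ball (A : Finset (Fin n → Bool)) (h : Fin n → Bool) (r : ℝ) : Finset (Fin n → Bool) :=
  {g ∈ A | distance h g ≤ r}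

/-- The disagreement region of `A`. -/
def DIS (A : Finset (Fin n → Bool)) : Finset (Fin n) :=
  {j | ∃ g ∈ A, ∃ g' ∈ A, g j ≠ g' j}

/-- The disagreement coefficient `sup_{h ∈ A} sup_{r > 0} |DIS(B_A(h, r))| / (r n)`.
The set is bounded above by `n`, since balls of radius less than `1 / n` are singletons. -/
def disagreementCoeff (A : Finset (Fin n → Bool)) : ℝ :=
  sSup {v : ℝ | ∃ h ∈ A, ∃ r : ℝ, 0 < r ∧ v = (#(DIS (ball A h r)) : ℝ) / (r * n)}

/-- The radius of the smallest ball centred at a member of `A` that contains `A`. -/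
def radius (A : Finset (Fin n → Bool)) : ℝ :=
  sInf {r : ℝ | ∃ h ∈ A, A ⊆ ball A h r}

/-- A uniformly random subset of `D` of size `a` (sampling without replacement); `a` is rounded
up, and the whole of `D` is taken when it has fewer than `a` elements. -/
def randomSubset (a : ℝ) (D : Finset (Fin n)) : PMF (Finset (Fin n)) :=
  PMF.uniformOfFinset (D.powersetCard (min ⌈a⌉₊ #D))
    (Finset.powersetCard_nonempty.2 (min_le_right _ _))

/-- Lower end of the confidence interval of width `w` around the empirical error on `S`. -/
def LB (y : Fin n → Bool) (w : ℝ) (S : Finset (Fin n)) (h : Fin n → Bool) : ℝ :=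
  err y S h - w / 2

/-- Upper end of the confidence interval of width `w` around the empirical error on `S`. -/
def UB (y : Fin n → Bool) (w : ℝ) (S : Finset (Fin n)) (h : Fin n → Bool) : ℝ :=
  err y S h + w / 2

/-- The classifiers of `A` whose lower bound does not exceed the least upper bound `β`. -/
def prune (y : Fin n → Bool) (w : ℝ) (S : Finset (Fin n)) (A : Finset (Fin n → Bool)) :
    Finset (Fin n → Bool) :=
  {h ∈ A | LB y w S h ≤ sInf (UB y w S '' (A : Set (Fin n → Bool)))}

/-- The classifiers of `A` with the least upper bound. -/
def argminUB (y : Fin n → Bool) (w : ℝ) (S : Finset (Fin n)) (A : Finset (Fin n → Bool)) :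
    Finset (Fin n → Bool) :=
  {h ∈ A | ∀ g ∈ A, UB y w S h ≤ UB y w S g}

/-- The numerical inputs of the algorithm: the constants in the sample sizes, the disagreement
coefficient, the VC dimension, and the accuracy and confidence parameters. -/
structure Params where
  c₁ : ℝ
  c₂ : ℝ
  b₁ : ℝ
  b₂ : ℝ
  θ : ℝ
  V : ℕ
  ε : ℝ
  δ : ℝ

/-- The confidence parameter `δ' = δ / (2 log₂ (2 n))` of a single iteration. -/
def Params.δ' (P : Params) (n : ℕ) : ℝ := P.δ / (2 * Real.logb 2 (2 * n))

/-- Sample size of an iteration of the main loop. -/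
def Params.loopSize (P : Params) (n : ℕ) : ℝ :=
  P.c₁ * P.θ ^ 2 * (P.V * Real.log P.θ + Real.log (1 / P.δ' n)) + P.b₁

/-- Sample size of the direct estimation phase. -/
def Params.finalSize (P : Params) : ℝ :=
  P.c₂ * P.θ ^ 2 / P.ε ^ 2 * (P.V * Real.log (P.θ / P.ε) + Real.log (1 / P.δ)) + P.b₂

/-- Width `UB - LB` of the confidence intervals in the main loop. -/
def Params.loopWidth (P : Params) : ℝ := 1 / (16 * P.θ)

/-- Width `UB - LB` of the confidence intervals in the direct estimation phase. -/
def Params.finalWidth (P : Params) : ℝ := P.ε / (16 * P.θ)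

/-- The direct estimation phase with candidate set `A`; `tie` breaks ties in the `arg min`. -/
def directEstimation (P : Params) (y : Fin n → Bool)
    (tie : Finset (Fin n → Bool) → (Fin n → Bool)) (A : Finset (Fin n → Bool)) :
    PMF (Option (Fin n → Bool)) :=
  (randomSubset P.finalSize (DIS A)).bind fun S' =>
    PMF.pure (some (tie (argminUB y P.finalWidth S' A)))

/-- The law of the output of the main loop, started with candidate set `A` and progress measure
`r` and run for at most `T` iterations; the output is `none` if it has not returned by then.
The labels `y` are used only through the errors on the sampled points. -/
def mainLoop (P : Params) (y : Fin n → Bool)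
    (tie : Finset (Fin n → Bool) → (Fin n → Bool)) :
    ℕ → Finset (Fin n → Bool) → ℝ → PMF (Option (Fin n → Bool))
  | 0, A, _ => if 1 < #A then PMF.pure none else PMF.pure (some (tie A))
  | T + 1, A, r =>
    if 1 < #A then
      (randomSubset (P.loopSize n) (DIS A)).bind fun S =>
        if radius (prune y P.loopWidth S A) > r / 2 then
          directEstimation P y tie A
        else
          mainLoop P y tie T (prune y P.loopWidth S A) (radius (prune y P.loopWidth S A))
    else
      PMF.pure (some (tie A))

/-- The law of the output of the active learning algorithm on the data points `x` with labels `y`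
and classifier class `H`, run for at most `T` iterations of its main loop. -/
def algorithm {X : Type*} (c₁ c₂ b₁ b₂ ε δ : ℝ) (x : Fin n → X) (y : Fin n → Bool)
    (H : Set (X → Bool)) (tie : Finset (Fin n → Bool) → (Fin n → Bool)) (T : ℕ) :
    PMF (Option (Fin n → Bool)) :=
  mainLoop
    { c₁ := c₁, c₂ := c₂, b₁ := b₁, b₂ := b₂, θ := disagreementCoeff (onData x H),
      V := (vcDim H).toNat, ε := ε, δ := δ }
    y tie T (onData x H) 1

/-- The error on the whole data set of an optimal classifier of `H`. -/
def optimalError {X : Type*} (x : Fin n → X) (y : Fin n → Bool) (H : Set (X → Bool)) : ℝ :=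
  sInf ((fun h : X → Bool => err y univ (h ∘ x)) '' H)

end ActiveLearning

end

noncomputable section

namespace ActiveLearning

open scoped Classical

/-! ### Sampling without replacement -/

/-! Let `g` be an optimal classifier, of error η, in a candidate set `A`, and let D = DIS(A).
Members of `A` agree off D, so their errors differ by the difference on D scaled by |D|/n, and |D| ≤
θ·radius(A)·n. Suppose a sample estimates all errors on D to within w/2, where w = 1/(16θ). Then `g`
survives the pruning, and every survivor errs on D at most 2w more than `g`. Two classifiers
disagree only where one of them errs, so survivors lie within 2η + radius(A)/8 of `g`
(`radius_prune_le`). Hence either the progress measure r halves, or η > (3/16)·radius(A). In the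
second case direct estimation loses at most ε·radius(A)/16 < εη (`err_univ_le_of_mem_argminUB`).
Halving ends with a single classifier once r·n < 1, because distinct classifiers are at distance at
least 1/n.

For the accuracy of the samples, cover `A` by balls. Members of a ball of s points around p differ
from p only on a region of at most θs points, so three frequencies per centre control the whole ball
(`randomSubset_uniform_deviation_le`). Each frequency obeys an exponential bound, since inclusion
events are negatively correlated. The cover is a maximal packing, whose size is bounded through the
VC dimension (`log_card_separated_le`).

One regime is delicate: V·ln(θ/ε) vanishes at θ = ε = 1, and the additive constants may not depend
on V. There the classifiers nearly form a chain, and packings have bounded size for every V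
(`card_separated_le_of_coeff_le`). -/

lemma choose_sub_mul_pow_le {N m : ℕ} (hm : m ≤ N) (j : ℕ) (hj : j ≤ m) :
    (N - j).choose (m - j) * N ^ j ≤ N.choose m * m ^ j := by
  induction j with
  | zero => simp
  | succ j ih =>
    have ih := ih (by omega)
    have h1 : (N - j) * (N - (j + 1)).choose (m - (j + 1)) = (N - j).choose (m - j) * (m - j) := by
      have := Nat.add_one_mul_choose_eq (N - (j + 1)) (m - (j + 1))
      rwa [show N - (j + 1) + 1 = N - j by omega, show m - (j + 1) + 1 = m - j by omega] at this
    -- Each factor (m - j)/(N - j) of the inclusion probability is at most m/N.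
    have h2 : (m - j) * N ≤ m * (N - j) := by
      rw [Nat.sub_mul, Nat.mul_sub]
      have : j * m ≤ j * N := Nat.mul_le_mul_left _ hm
      have : m * j = j * m := mul_comm _ _
      omega
    have h3 : 0 < N - j := by omega
    refine Nat.le_of_mul_le_mul_left ?_ h3
    calc (N - j) * ((N - (j + 1)).choose (m - (j + 1)) * N ^ (j + 1))
        = ((N - j) * (N - (j + 1)).choose (m - (j + 1))) * N ^ j * N := by ring
      _ = ((N - j).choose (m - j) * N ^ j) * ((m - j) * N) := by rw [h1]; ring
      _ ≤ (N.choose m * m ^ j) * (m * (N - j)) := Nat.mul_le_mul ih h2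
      _ = (N - j) * (N.choose m * m ^ (j + 1)) := by ring

/-- Inclusion events are negatively correlated under sampling without replacement. -/
lemma card_superset_mul_pow_le {α : Type*} {D T : Finset α} {m : ℕ} (hm : m ≤ #D) (hT : T ⊆ D) :
    #{S ∈ D.powersetCard m | T ⊆ S} * #D ^ #T ≤ (#D).choose m * m ^ #T := by
  by_cases h : #T ≤ m
  · rw [card_filter_powersetCard_subset _ _ _ hT h]
    exact choose_sub_mul_pow_le hm _ h
  · rw [card_eq_zero.2, zero_mul]
    · exact Nat.zero_le _
    · refine filter_eq_empty_iff.2 fun S hS hTS => h ?_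
      rw [← (mem_powersetCard.1 hS).2]
      exact card_le_card hTS

/-- A bound on the moment generating function of the number of sampled points with property `p`. -/
lemma sum_powersetCard_pow_le {α : Type*} {D : Finset α} (p : α → Prop) {m : ℕ} (hm : m ≤ #D)
    (hD : 0 < #D) {a : ℝ} (ha : 0 ≤ a) :
    ∑ S ∈ D.powersetCard m, (1 + a) ^ #{j ∈ S | p j} ≤
      (#D).choose m * Real.exp (a * m * ((#{j ∈ D | p j} : ℝ) / #D)) := by
  have hD' : (0 : ℝ) < #D := by exact_mod_cast hD
  -- Expanding over sets of marked sampled points leaves only inclusion counts; once these are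
  -- bounded, the binomial theorem reassembles the sum as for independent draws.
  have h1 : ∀ S ∈ D.powersetCard m, (1 + a) ^ #{j ∈ S | p j} =
      ∑ T ∈ (D.filter p).powerset, if T ⊆ S then a ^ #T else 0 := by
    intro S hS
    have hSD := (mem_powersetCard.1 hS).1
    rw [← sum_filter]
    have : {T ∈ (D.filter p).powerset | T ⊆ S} = (S.filter p).powerset := by
      ext T
      simp only [mem_filter, mem_powerset, subset_iff]
      constructor
      · rintro ⟨h1, h2⟩ t ht
        exact ⟨h2 ht, (h1 ht).2⟩
      · intro h
        exact ⟨fun t ht => ⟨hSD (h ht).1, (h ht).2⟩, fun t ht => (h ht).1⟩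
    rw [this, add_comm, ← sum_pow_mul_eq_add_pow]
    simp
  rw [sum_congr rfl h1, sum_comm]
  calc ∑ T ∈ (D.filter p).powerset, ∑ S ∈ D.powersetCard m, (if T ⊆ S then a ^ #T else 0)
      ≤ ∑ T ∈ (D.filter p).powerset, (#D).choose m * (a * m / #D) ^ #T := by
        refine sum_le_sum fun T hT => ?_
        rw [← sum_filter, sum_const, nsmul_eq_mul]
        have hTD : T ⊆ D := (mem_powerset.1 hT).trans (filter_subset _ _)
        have := card_superset_mul_pow_le hm hTD
        have h : (#{S ∈ D.powersetCard m | T ⊆ S} : ℝ) * #D ^ #T ≤ (#D).choose m * m ^ #T := by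
          exact_mod_cast this
        rw [mul_div_assoc, mul_pow, div_pow]
        rw [← le_div_iff₀ (by positivity)] at h
        calc _ ≤ ((#D).choose m * (m : ℝ) ^ #T / #D ^ #T) * a ^ #T := by gcongr
          _ = _ := by ring
    _ = (#D).choose m * (1 + a * m / #D) ^ #(D.filter p) := by
        rw [← mul_sum, add_comm (1 : ℝ), ← sum_pow_mul_eq_add_pow]
        simp
    _ ≤ _ := by
        gcongr
        calc (1 + a * m / #D) ^ #(D.filter p) ≤ (Real.exp (a * m / #D)) ^ #(D.filter p) := by
              gcongr
              rw [add_comm]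
              exact Real.add_one_le_exp _
          _ = _ := by
            rw [← Real.exp_nat_mul]
            congr 1
            ring

lemma card_sample_deviation_le {α : Type*} {D : Finset α} (p : α → Prop) {m : ℕ} (hm : m ≤ #D)
    (hm0 : 0 < m) {γ : ℝ} (hγ : 0 < γ) (hγ1 : γ ≤ 1) :
    (#{S ∈ D.powersetCard m |
        (#{j ∈ D | p j} : ℝ) / #D + γ ≤ (#{j ∈ S | p j} : ℝ) / #S} : ℝ) ≤
      (#D).choose m * Real.exp (-(γ ^ 2 * m / 4)) := by
  have hD : 0 < #D := by omega
  have hm' : (0 : ℝ) < m := by exact_mod_cast hm0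
  set q : ℝ := (#{j ∈ D | p j} : ℝ) / #D with hq
  have hq1 : q ≤ 1 := div_le_one_of_le₀ (by exact_mod_cast card_filter_le _ _) (by positivity)
  have hq0 : 0 ≤ q := by positivity
  -- Chernoff's method: as e^l - 1 ≤ l + l² and q ≤ 1, the exponent is at most m(l² - lγ), minimal
  -- at l = γ/2.
  set l : ℝ := γ / 2 with hl
  have ha : 0 ≤ Real.exp l - 1 := by
    have := Real.add_one_le_exp l
    have : 0 < l := by positivity
    linarith
  have hmgf := sum_powersetCard_pow_le p hm hD ha
  rw [← hq, add_sub_cancel] at hmgf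
  set B := {S ∈ D.powersetCard m | q + γ ≤ (#{j ∈ S | p j} : ℝ) / #S} with hB
  have h1 : (#B : ℝ) * Real.exp (l * (m * (q + γ))) ≤
      ∑ S ∈ D.powersetCard m, Real.exp l ^ #{j ∈ S | p j} := by
    calc (#B : ℝ) * Real.exp (l * (m * (q + γ))) = ∑ S ∈ B, Real.exp (l * (m * (q + γ))) := by
          rw [sum_const, nsmul_eq_mul]
      _ ≤ ∑ S ∈ B, Real.exp l ^ #{j ∈ S | p j} := by
          refine sum_le_sum fun S hS => ?_
          obtain ⟨hS1, hS2⟩ := mem_filter.1 hS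
          rw [(mem_powersetCard.1 hS1).2, le_div_iff₀ hm'] at hS2
          rw [← Real.exp_nat_mul, Real.exp_le_exp]
          have : 0 < l := by positivity
          nlinarith
      _ ≤ _ := sum_le_sum_of_subset_of_nonneg (filter_subset _ _) fun _ _ _ => by positivity
  have h2 : Real.exp l - 1 ≤ l + l ^ 2 := by
    have := (abs_le.1 (Real.abs_exp_sub_one_sub_id_le (x := l) (by
      rw [abs_of_pos (by positivity)]; linarith))).2
    linarith
  have h3 : (#B : ℝ) * Real.exp (l * (m * (q + γ))) ≤
      (#D).choose m * Real.exp ((l + l ^ 2) * m * q) := by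
    refine (h1.trans hmgf).trans ?_
    gcongr
  rw [← le_div_iff₀ (Real.exp_pos _), mul_div_assoc, ← Real.exp_sub] at h3
  refine h3.trans ?_
  gcongr
  have : l ^ 2 * m * q ≤ l ^ 2 * m * 1 := by gcongr
  rw [hl] at *
  nlinarith

lemma uniformOfFinset_toOuterMeasure_le {α : Type*} {s : Finset α} (hs : s.Nonempty) (t : Set α)
    {q : ℝ} (h : (#{x ∈ s | x ∈ t} : ℝ) ≤ #s * q) :
    (PMF.uniformOfFinset s hs).toOuterMeasure t ≤ ENNReal.ofReal q := by
  rw [PMF.toOuterMeasure_uniformOfFinset_apply]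
  have hs0 : (0 : ℝ) < #s := by exact_mod_cast hs.card_pos
  refine ENNReal.div_le_of_le_mul ?_
  rw [← ENNReal.ofReal_natCast, ← ENNReal.ofReal_natCast, ← ENNReal.ofReal_mul' (by positivity)]
  refine ENNReal.ofReal_le_ofReal ?_
  rw [mul_comm]
  exact h

variable {n : ℕ}

/-- A Hoeffding-type bound for the upper deviation of an empirical frequency under sampling
without replacement. -/
lemma randomSubset_deviation_le {D : Finset (Fin n)} (p : Fin n → Prop)
    {a γ : ℝ} (ha : 0 < a) (hγ : 0 < γ) (hγ1 : γ ≤ 1) :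
    (randomSubset a D).toOuterMeasure
        {S | (#{j ∈ D | p j} : ℝ) / #D + γ ≤ (#{j ∈ S | p j} : ℝ) / #S} ≤
      ENNReal.ofReal (Real.exp (-(γ ^ 2 * a / 4))) := by
  refine uniformOfFinset_toOuterMeasure_le _ _ ?_
  rw [card_powersetCard]
  have hc : 0 < ⌈a⌉₊ := Nat.ceil_pos.2 ha
  rcases le_total ⌈a⌉₊ (#D) with h | h
  · rw [min_eq_left h]
    refine (card_sample_deviation_le p h hc hγ hγ1).trans ?_
    gcongr
    exact Nat.le_ceil a
  -- The sample is all of `D`, so the two frequencies agree and the event is empty.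
  · rw [min_eq_right h, powersetCard_self]
    rw [show ({S ∈ ({D} : Finset (Finset (Fin n))) | S ∈ {S : Finset (Fin n) |
      (#{j ∈ D | p j} : ℝ) / #D + γ ≤ (#{j ∈ S | p j} : ℝ) / #S}}) = ∅ from ?_]
    · simp only [card_empty, Nat.cast_zero]
      positivity
    · refine filter_eq_empty_iff.2 fun S hS h => ?_
      rw [mem_singleton.1 hS] at h
      simp only [Set.mem_ofPred_eq] at h
      linarith

lemma randomSubset_support_nonempty {D S : Finset (Fin n)} {a : ℝ} (ha : 0 < a) (hD : D.Nonempty)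
    (h : S ∈ (randomSubset a D).support) : S.Nonempty := by
  rw [randomSubset, PMF.mem_support_uniformOfFinset_iff, mem_powersetCard] at h
  rw [← card_pos, h.2]
  exact lt_min (Nat.ceil_pos.2 ha) hD.card_pos

/-! ### Disagreement regions -/

lemma DIS_mono {A B : Finset (Fin n → Bool)} (h : A ⊆ B) : DIS A ⊆ DIS B := by
  intro j hj
  simp only [DIS, mem_filter, mem_univ, true_and] at hj ⊢
  obtain ⟨g, hg, g', hg', hne⟩ := hj
  exact ⟨g, h hg, g', h hg', hne⟩

lemma mem_DIS {A : Finset (Fin n → Bool)} {g g' : Fin n → Bool} (hg : g ∈ A) (hg' : g' ∈ A)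
    {j : Fin n} (h : g j ≠ g' j) : j ∈ DIS A := by
  simp only [DIS, mem_filter, mem_univ, true_and]
  exact ⟨g, hg, g', hg', h⟩

lemma disagreement_eq_filter_DIS {A : Finset (Fin n → Bool)} {g g' : Fin n → Bool} (hg : g ∈ A)
    (hg' : g' ∈ A) : ({j | g j ≠ g' j} : Finset (Fin n)) = {j ∈ DIS A | g j ≠ g' j} := by
  ext j
  simp only [mem_filter, mem_univ, true_and]
  exact ⟨fun h => ⟨mem_DIS hg hg' h, h⟩, fun h => h.2⟩

lemma card_disagreement_le_DIS {A : Finset (Fin n → Bool)} {g g' : Fin n → Bool} (hg : g ∈ A)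
    (hg' : g' ∈ A) : #{j | g j ≠ g' j} ≤ #(DIS A) := by
  rw [disagreement_eq_filter_DIS hg hg']
  exact card_filter_le _ _

lemma card_disagreement_pos {g g' : Fin n → Bool} (h : g ≠ g') : 0 < #{j | g j ≠ g' j} := by
  obtain ⟨j, hj⟩ := Function.ne_iff.1 h
  exact card_pos.2 ⟨j, by simpa using hj⟩

lemma DIS_nonempty {A : Finset (Fin n → Bool)} (hA : 1 < #A) : (DIS A).Nonempty := by
  obtain ⟨g, hg, g', hg', hne⟩ := one_lt_card.1 hA
  obtain ⟨j, hj⟩ := Function.ne_iff.1 hne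
  exact ⟨j, mem_DIS hg hg' hj⟩

lemma mul_distance (hn : 0 < n) (h g : Fin n → Bool) :
    distance h g * n = #{j : Fin n | h j ≠ g j} := by
  have : (n : ℝ) ≠ 0 := by positivity
  rw [distance, div_mul_cancel₀ _ this]

/-- Makes the `sSup` in `disagreementCoeff` a true supremum rather than a default value. -/
lemma disagreementCoeff_bddAbove (hn : 0 < n) (A : Finset (Fin n → Bool)) :
    BddAbove {v : ℝ | ∃ h ∈ A, ∃ r : ℝ, 0 < r ∧
      v = (#(DIS (ball A h r)) : ℝ) / (r * n)} := by
  have hn' : (0 : ℝ) < n := by exact_mod_cast hn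
  refine ⟨n, ?_⟩
  rintro v ⟨h, -, r, hr, rfl⟩
  rcases lt_or_ge (r * n) 1 with hrn | hrn
  · have hball : ∀ g ∈ ball A h r, g = h := by
      intro g hg
      by_contra hne
      have h1 := (mem_filter.1 hg).2
      have h2 : 1 ≤ #{j : Fin n | h j ≠ g j} := card_disagreement_pos (Ne.symm hne)
      have h3 : (1 : ℝ) ≤ distance h g * n := by
        rw [mul_distance hn]; exact_mod_cast h2
      have : distance h g * n ≤ r * n := by gcongr
      linarith
    have : DIS (ball A h r) = ∅ := by
      refine filter_eq_empty_iff.2 fun j _ => ?_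
      rintro ⟨g, hg, g', hg', hne⟩
      rw [hball g hg, hball g' hg'] at hne
      exact hne rfl
    rw [this]
    simp
  · rw [div_le_iff₀ (by positivity)]
    have : #(DIS (ball A h r)) ≤ n := by
      simpa using card_le_univ (DIS (ball A h r))
    have : (#(DIS (ball A h r)) : ℝ) ≤ n := by exact_mod_cast this
    nlinarith

/-- The defining property of the disagreement coefficient, in terms of numbers of points. -/
lemma card_DIS_le_of_forall (hn : 0 < n) {A B : Finset (Fin n → Bool)} {h : Fin n → Bool}
    (hh : h ∈ A) (hB : B ⊆ A) {s : ℝ} (hs : 0 < s)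
    (hd : ∀ g ∈ B, (#{j : Fin n | h j ≠ g j} : ℝ) ≤ s) :
    (#(DIS B) : ℝ) ≤ disagreementCoeff A * s := by
  have hn' : (0 : ℝ) < n := by exact_mod_cast hn
  have hsub : B ⊆ ball A h (s / n) := by
    intro g hg
    refine mem_filter.2 ⟨hB hg, ?_⟩
    rw [le_div_iff₀ hn', mul_distance hn]
    exact hd g hg
  have hle : (#(DIS B) : ℝ) / (s / n * n) ≤ disagreementCoeff A := by
    refine le_trans ?_ (le_csSup (disagreementCoeff_bddAbove hn A)
      ⟨h, hh, s / n, by positivity, rfl⟩)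
    have := card_le_card (DIS_mono hsub)
    gcongr
  rwa [div_mul_cancel₀ _ hn'.ne', div_le_iff₀ hs] at hle

/-- A pair of distinct classifiers is a ball whose disagreement region is as large as its radius
allows. -/
lemma one_le_disagreementCoeff (hn : 0 < n) {A : Finset (Fin n → Bool)} (hA : 1 < #A) :
    1 ≤ disagreementCoeff A := by
  obtain ⟨g, hg, g', hg', hne⟩ := one_lt_card.1 hA
  have hpos : (0 : ℝ) < #{j : Fin n | g j ≠ g' j} := by exact_mod_cast card_disagreement_pos hne
  have hB : ({g, g'} : Finset (Fin n → Bool)) ⊆ A := by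
    intro k hk
    rcases mem_insert.1 hk with rfl | hk
    · exact hg
    · rwa [mem_singleton.1 hk]
  have h1 := card_DIS_le_of_forall hn hg hB hpos (by
    intro k hk
    rcases mem_insert.1 hk with rfl | hk
    · simp
    · rw [mem_singleton.1 hk])
  have h2 : (#{j : Fin n | g j ≠ g' j} : ℝ) ≤ #(DIS ({g, g'} : Finset (Fin n → Bool))) := by
    exact_mod_cast card_disagreement_le_DIS (by simp) (by simp)
  exact le_of_mul_le_mul_right (by linarith) hpos

/-! ### Packings -/

/-- The members of `P` differ pairwise on more than `s` points. -/
def Separated (s : ℝ) (P : Finset (Fin n → Bool)) : Prop :=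
  ∀ g ∈ P, ∀ g' ∈ P, g ≠ g' → s < #{j : Fin n | g j ≠ g' j}

/-- A maximal packing is a cover. -/
lemma exists_separated_cover (A : Finset (Fin n → Bool)) {s : ℝ} (hs : 0 ≤ s) :
    ∃ P ⊆ A, Separated s P ∧ ∀ h ∈ A, ∃ p ∈ P, (#{j : Fin n | p j ≠ h j} : ℝ) ≤ s := by
  obtain ⟨P, hP, hmax⟩ := exists_max_image (A.powerset.filter (Separated s)) card
    ⟨∅, by simp [Separated]⟩
  obtain ⟨hPA, hsep⟩ := mem_filter.1 hP
  rw [mem_powerset] at hPA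
  refine ⟨P, hPA, hsep, fun h hh => ?_⟩
  by_contra! hfar
  have hhP : h ∉ P := by
    intro hhP
    have := hfar h hhP
    simp at this
    linarith
  have hins : insert h P ∈ A.powerset.filter (Separated s) := by
    refine mem_filter.2 ⟨mem_powerset.2 (insert_subset hh hPA), ?_⟩
    intro g hg g' hg' hne
    rcases mem_insert.1 hg with rfl | hgP
    · rcases mem_insert.1 hg' with rfl | hgP'
      · exact absurd rfl hne
      · simpa only [ne_comm] using hfar g' hgP'
    · rcases mem_insert.1 hg' with rfl | hgP'
      · exact hfar g hgP
      · exact hsep g hgP g' hgP' hne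
  have := hmax _ hins
  rw [card_insert_of_notMem hhP] at this
  omega

/-- Few random points distinguish the members of a packing. -/
lemma exists_distinguishing {P : Finset (Fin n → Bool)} {D : Finset (Fin n)} (hD : D.Nonempty)
    (hP : P.Nonempty) {ρ : ℝ} (hρ1 : ρ ≤ 1)
    (hsep : ∀ g ∈ P, ∀ g' ∈ P, g ≠ g' → ρ * #D ≤ #{j ∈ D | g j ≠ g' j}) {k : ℕ}
    (hk : (#P : ℝ) ^ 2 * (1 - ρ) ^ k ≤ 1) :
    ∃ U : Finset (Fin n), #U ≤ k ∧ ∀ g ∈ P, ∀ g' ∈ P, (∀ j ∈ U, g j = g' j) → g = g' := by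
  -- Probabilistic method with k independent draws from `D`, written as a union bound: otherwise
  -- every k-tuple lies in the agreement set of some ordered pair of distinct members.
  by_contra! hcon
  have hD' : (0 : ℝ) < #D := by exact_mod_cast hD.card_pos
  have hP' : (0 : ℝ) < #P := by exact_mod_cast hP.card_pos
  have hsub : Fintype.piFinset (fun _ : Fin k => D) ⊆ P.offDiag.biUnion fun q =>
      Fintype.piFinset (fun _ : Fin k => {j ∈ D | q.1 j = q.2 j}) := by
    intro f hf
    rw [Fintype.mem_piFinset] at hf
    obtain ⟨g, hg, g', hg', heq, hne⟩ := hcon (univ.image f) (by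
      simpa using card_image_le (s := (univ : Finset (Fin k))) (f := f))
    refine mem_biUnion.2 ⟨(g, g'), mem_offDiag.2 ⟨hg, hg', hne⟩, ?_⟩
    rw [Fintype.mem_piFinset]
    exact fun i => mem_filter.2 ⟨hf i, heq _ (mem_image_of_mem _ (mem_univ i))⟩
  have h1 := (card_le_card hsub).trans card_biUnion_le
  have h2 : ((#D : ℝ)) ^ k ≤ ∑ q ∈ P.offDiag, (#{j ∈ D | q.1 j = q.2 j} : ℝ) ^ k := by
    have : (#D) ^ k ≤ ∑ q ∈ P.offDiag, (#{j ∈ D | q.1 j = q.2 j}) ^ k := by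
      simpa [Fintype.card_piFinset] using h1
    exact_mod_cast this
  have h3 : ∀ q ∈ P.offDiag, (#{j ∈ D | q.1 j = q.2 j} : ℝ) ^ k ≤ ((1 - ρ) * #D) ^ k := by
    intro q hq
    obtain ⟨hq1, hq2, hne⟩ := mem_offDiag.1 hq
    have h4 := hsep _ hq1 _ hq2 hne
    have h5 : (#{j ∈ D | q.1 j = q.2 j} : ℝ) + #{j ∈ D | q.1 j ≠ q.2 j} = #D := by
      exact_mod_cast card_filter_add_card_filter_not (s := D) (fun j => q.1 j = q.2 j)
    gcongr
    linarith
  have h6 := h2.trans (sum_le_sum h3)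
  rw [sum_const, nsmul_eq_mul, mul_pow, ← mul_assoc] at h6
  have h7 : 1 ≤ (#P.offDiag : ℝ) * (1 - ρ) ^ k :=
    le_of_mul_le_mul_right (by linarith) (pow_pos hD' k)
  -- Counting only off-diagonal pairs saves the term |P|, which gives the contradiction even when
  -- `hk` is an equality.
  have h8 : (#P.offDiag : ℝ) = (#P : ℝ) ^ 2 - #P := by
    rw [offDiag_card, Nat.cast_sub (Nat.le_mul_self _)]
    push_cast
    ring
  rw [h8] at h7
  have h9 : 0 ≤ (1 - ρ) ^ k := pow_nonneg (by linarith) k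
  have h10 : (#P : ℝ) * (1 - ρ) ^ k ≤ 0 := by nlinarith
  have h11 : (1 - ρ) ^ k = 0 := by
    rcases h9.lt_or_eq with h | h
    · exact absurd h10 (not_le.2 (mul_pos hP' h))
    · exact h.symm
  rw [h11] at h7
  linarith

lemma mem_onData {X : Type*} {x : Fin n → X} {H : Set (X → Bool)} {g : Fin n → Bool} :
    g ∈ onData x H ↔ ∃ h ∈ H, h ∘ x = g := by
  simp [onData]

lemma card_le_toNat_vcDim {X : Type*} {H : Set (X → Bool)} (hH : vcDim H ≠ ⊤) {T : Finset X}
    (hT : Shatters H T) : #T ≤ (vcDim H).toNat := by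
  have h1 : (#T : ℕ∞) ≤ vcDim H := le_iSup₂_of_le T hT le_rfl
  exact (ENat.natCast_le_natCast).1 (h1.trans_eq (ENat.natCast_toNat hH).symm)

/-- A form of the Sauer-Shelah lemma. -/
lemma card_mul_pow_le_of_distinguishing {X : Type*} {x : Fin n → X} {H : Set (X → Bool)}
    (hH : vcDim H ≠ ⊤) {P : Finset (Fin n → Bool)} (hP : P ⊆ onData x H) {U : Finset (Fin n)}
    (hU : ∀ g ∈ P, ∀ g' ∈ P, (∀ j ∈ U, g j = g' j) → g = g') {z : ℝ} (hz : 0 ≤ z) (hz1 : z ≤ 1) :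
    (#P : ℝ) * z ^ (vcDim H).toNat ≤ Real.exp (z * #U) := by
  set F : Finset (Finset (Fin n)) := P.image fun g => {j ∈ U | g j = true} with hF
  have hFP : #F = #P := by
    refine card_image_of_injOn fun g hg g' hg' heq => hU g hg g' hg' fun j hj => ?_
    have := Finset.ext_iff.1 heq j
    simp only [mem_filter, hj, true_and] at this
    exact Bool.eq_iff_iff.2 this
  have hsh : ∀ T ∈ F.shatterer, T ⊆ U ∧ #T ≤ (vcDim H).toNat := by
    intro T hT
    rw [mem_shatterer] at hT
    have hTU : T ⊆ U := by
      obtain ⟨t, ht, hTt⟩ := hT.exists_superset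
      obtain ⟨g, -, rfl⟩ := mem_image.1 ht
      exact hTt.trans (filter_subset _ _)
    refine ⟨hTU, ?_⟩
    have hreal : ∀ t ⊆ T, ∃ h ∈ H, ∀ j ∈ T, h (x j) = true ↔ j ∈ t := by
      intro t ht
      obtain ⟨u, hu, hut⟩ := hT ht
      obtain ⟨g, hg, rfl⟩ := mem_image.1 hu
      obtain ⟨h, hh, rfl⟩ := mem_onData.1 (hP hg)
      refine ⟨h, hh, fun j hj => ?_⟩
      rw [← hut]
      simp [hj, hTU hj]
    -- Indices with the same data point cannot be told apart, so a shattered index set maps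
    -- injectively to a shattered set of points.
    have hinj : Set.InjOn x T := by
      intro i hi j hj hij
      obtain ⟨h, -, hh⟩ := hreal {i} (singleton_subset_iff.2 hi)
      have h1 := (hh i hi).2 (mem_singleton_self i)
      rw [hij] at h1
      exact (mem_singleton.1 ((hh j hj).1 h1)).symm
    rw [← card_image_of_injOn hinj]
    refine card_le_toNat_vcDim hH fun g => ?_
    obtain ⟨h, hhH, hh⟩ := hreal {j ∈ T | g (x j) = true} (filter_subset _ _)
    refine ⟨h, hhH, fun t ht => ?_⟩
    obtain ⟨j, hj, rfl⟩ := mem_image.1 ht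
    have := hh j hj
    simp only [mem_filter, hj, true_and] at this
    exact Bool.eq_iff_iff.2 this
  -- A family shatters at least as many sets as it has members; the weights z^|T| replace the usual
  -- sum of binomial coefficients.
  calc (#P : ℝ) * z ^ (vcDim H).toNat ≤ #F.shatterer * z ^ (vcDim H).toNat := by
        have : #P ≤ #F.shatterer := hFP ▸ card_le_card_shatterer F
        gcongr
    _ = ∑ T ∈ F.shatterer, z ^ (vcDim H).toNat := by rw [sum_const, nsmul_eq_mul]
    _ ≤ ∑ T ∈ F.shatterer, z ^ #T :=
        sum_le_sum fun T hT => pow_le_pow_of_le_one hz hz1 (hsh T hT).2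
    _ ≤ ∑ T ∈ U.powerset, z ^ #T :=
        sum_le_sum_of_subset_of_nonneg (fun T hT => mem_powerset.2 (hsh T hT).1)
          fun _ _ _ => by positivity
    _ = (z + 1) ^ #U := by rw [← sum_pow_mul_eq_add_pow]; simp
    _ ≤ Real.exp z ^ #U := by gcongr; exact Real.add_one_le_exp z
    _ = Real.exp (z * #U) := by rw [← Real.exp_nat_mul, mul_comm]

/-- Packing numbers of a class of finite VC dimension. -/
lemma log_card_separated_le {X : Type*} {x : Fin n → X} {H : Set (X → Bool)}
    (hH : vcDim H ≠ ⊤) {A P : Finset (Fin n → Bool)} (hA : A ⊆ onData x H) (hA1 : 1 < #A)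
    (hPA : P ⊆ A) (hP : P.Nonempty) {ρ : ℝ} (hρ : 0 < ρ) (hρ1 : ρ ≤ 1)
    (hsep : Separated (ρ * #(DIS A)) P) :
    Real.log #P ≤ 2 * (vcDim H).toNat * Real.log (4 / ρ) + 1 := by
  have hP0 : (0 : ℝ) < #P := by exact_mod_cast hP.card_pos
  have hP1 : (1 : ℝ) ≤ #P := by exact_mod_cast hP.card_pos
  set L := Real.log #P with hL
  have hL0 : 0 ≤ L := Real.log_nonneg hP1
  obtain ⟨U, hUk, hU⟩ := exists_distinguishing (P := P) (k := ⌈2 * L / ρ⌉₊) (DIS_nonempty hA1) hP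
    hρ1 (fun g hg g' hg' hne => by
      rw [← disagreement_eq_filter_DIS (hPA hg) (hPA hg')]
      exact (hsep g hg g' hg' hne).le) (by
      have h1 : (1 - ρ) ^ ⌈2 * L / ρ⌉₊ ≤ Real.exp (-ρ) ^ ⌈2 * L / ρ⌉₊ := by
        have : 0 ≤ 1 - ρ := by linarith
        gcongr
        exact Real.one_sub_le_exp_neg ρ
      have h2 : (#P : ℝ) ^ 2 = Real.exp (2 * L) := by
        rw [two_mul, Real.exp_add, hL, Real.exp_log hP0, sq]
      have h3 := (div_le_iff₀ hρ).1 (Nat.le_ceil (2 * L / ρ))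
      rw [h2]
      calc _ ≤ Real.exp (2 * L) * Real.exp (-ρ) ^ ⌈2 * L / ρ⌉₊ := by gcongr
        _ = Real.exp (2 * L + ⌈2 * L / ρ⌉₊ * (-ρ)) := by
          rw [← Real.exp_nat_mul, ← Real.exp_add]
        _ ≤ 1 := Real.exp_le_one_iff.2 (by linarith))
  -- The number of distinguishing points itself depends on L = log |P|; z = ρ/4 makes their
  -- contribution about L/2, which the left side absorbs.
  have h1 := card_mul_pow_le_of_distinguishing hH (hPA.trans hA) hU (z := ρ / 4) (by positivity)
    (by linarith)
  have h2 := Real.log_le_log (by positivity) h1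
  rw [Real.log_exp, Real.log_mul hP0.ne' (by positivity), Real.log_pow,
    ← neg_neg (Real.log (ρ / 4)), ← Real.log_inv, inv_div] at h2
  have h3 : (#U : ℝ) ≤ 2 * L / ρ + 1 := by
    have := Nat.ceil_lt_add_one (show 0 ≤ 2 * L / ρ by positivity)
    have : (#U : ℝ) ≤ ⌈2 * L / ρ⌉₊ := by exact_mod_cast hUk
    linarith
  have h4 : ρ / 4 * #U ≤ L / 2 + ρ / 4 := by
    calc ρ / 4 * #U ≤ ρ / 4 * (2 * L / ρ + 1) := by gcongr
      _ = _ := by field_simp; ring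
  linarith

/-- If the disagreement coefficient is close to one, then the disagreements with a fixed
classifier nearly form a chain, so that packings are small whatever the VC dimension. -/
lemma card_separated_le_of_coeff_le (hn : 0 < n) {A₀ A P : Finset (Fin n → Bool)} (hA : A ⊆ A₀)
    (hA1 : 1 < #A) (hPA : P ⊆ A) {ρ : ℝ} (hθ : disagreementCoeff A₀ ≤ 1001 / 1000)
    (hρ : 7 / 1000 ≤ ρ) (hsep : Separated (ρ * #(DIS A)) P) : #P ≤ 201 := by
  obtain ⟨h, hh⟩ : A.Nonempty := card_pos.1 (by omega)
  have hD : (0 : ℝ) < #(DIS A) := by exact_mod_cast (DIS_nonempty hA1).card_pos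
  set θ := disagreementCoeff A₀
  set d : (Fin n → Bool) → ℕ := fun g => #{j : Fin n | h j ≠ g j} with hd
  have hdD : ∀ g ∈ A, (d g : ℝ) ≤ #(DIS A) := fun g hg => by
    exact_mod_cast card_disagreement_le_DIS hh hg
  -- The region where `g` or `g'` differs from `h` has at most θ·d(g') points, so `g` and `g'`
  -- differ on at most (d(g') - d(g)) + 2(θ - 1)d(g') points. This is at most (5 + 2)/1000 of |DIS
  -- A|, against the separation.
  have key : ∀ g ∈ P, ∀ g' ∈ P, d g ≤ d g' → (d g' : ℝ) - d g ≤ #(DIS A) / 200 → g = g' := by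
    intro g hg g' hg' hle hclose
    by_contra hne
    have hfar := hsep g hg g' hg' hne
    have hd'D := hdD g' (hPA hg')
    have hcount : #{j : Fin n | g j ≠ g' j} + d g + d g' =
        2 * #{j : Fin n | h j ≠ g j ∨ h j ≠ g' j} := by
      simp only [hd, card_filter, mul_sum, ← sum_add_distrib]
      refine sum_congr rfl fun j _ => ?_
      cases g j <;> cases g' j <;> cases h j <;> simp
    rcases Nat.eq_zero_or_pos (d g') with h0 | hpos
    · have hs : #{j : Fin n | h j ≠ g j ∨ h j ≠ g' j} ≤ d g + d g' := by
        rw [filter_or]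
        exact card_union_le _ _
      have : #{j : Fin n | g j ≠ g' j} = 0 := by omega
      rw [this] at hfar
      push_cast at hfar
      nlinarith
    · have hB : ({h, g, g'} : Finset (Fin n → Bool)) ⊆ A₀ := by
        intro k hk
        simp only [mem_insert, mem_singleton] at hk
        rcases hk with rfl | rfl | rfl
        · exact hA hh
        · exact hA (hPA hg)
        · exact hA (hPA hg')
      have h1 := card_DIS_le_of_forall hn (hA hh) hB (s := d g') (by exact_mod_cast hpos) (by
        intro k hk
        simp only [mem_insert, mem_singleton] at hk
        rcases hk with rfl | rfl | rfl
        · simp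
        · exact_mod_cast hle
        · exact le_rfl)
      have h2 : #{j : Fin n | h j ≠ g j ∨ h j ≠ g' j} ≤
          #(DIS ({h, g, g'} : Finset (Fin n → Bool))) := by
        refine card_le_card fun j hj => ?_
        rcases (mem_filter.1 hj).2 with h3 | h3
        · exact mem_DIS (by simp) (by simp) h3
        · exact mem_DIS (by simp) (by simp) h3
      have h2' : (#{j : Fin n | h j ≠ g j ∨ h j ≠ g' j} : ℝ) ≤
          #(DIS ({h, g, g'} : Finset (Fin n → Bool))) := by exact_mod_cast h2
      have hcount' : (#{j : Fin n | g j ≠ g' j} : ℝ) + d g + d g' =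
          2 * #{j : Fin n | h j ≠ g j ∨ h j ≠ g' j} := by exact_mod_cast hcount
      have h4 : θ * d g' ≤ 1001 / 1000 * d g' := by gcongr
      have h5 : 7 / 1000 * (#(DIS A) : ℝ) ≤ ρ * #(DIS A) := by gcongr
      linarith
  -- Pigeonhole: cells of width |DIS A|/200 for `d`, the 201st holding the maximal value.
  have hmaps : ∀ g ∈ P, ⌊200 * (d g : ℝ) / #(DIS A)⌋₊ ∈ range 201 := by
    intro g hg
    rw [mem_range, Nat.floor_lt (by positivity), div_lt_iff₀ hD]
    have := hdD g (hPA hg)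
    push_cast
    linarith
  have hinj : Set.InjOn (fun g => ⌊200 * (d g : ℝ) / #(DIS A)⌋₊) P := by
    intro g hg g' hg' heq
    have hclose : ∀ a b : ℕ, ⌊200 * (a : ℝ) / #(DIS A)⌋₊ = ⌊200 * (b : ℝ) / #(DIS A)⌋₊ →
        (b : ℝ) - a ≤ #(DIS A) / 200 := by
      intro a b hab
      have h1 := Nat.floor_le (show 0 ≤ 200 * (a : ℝ) / #(DIS A) by positivity)
      have h2 := Nat.lt_floor_add_one (200 * (b : ℝ) / #(DIS A))
      rw [← hab] at h2
      have h3 : 200 * (b : ℝ) / #(DIS A) < 200 * (a : ℝ) / #(DIS A) + 1 := by linarith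
      rw [div_add_one hD.ne', div_lt_div_iff_of_pos_right hD] at h3
      linarith
    rcases le_total (d g) (d g') with hle | hle
    · exact key g hg g' hg' hle (hclose _ _ heq)
    · exact (key g' hg' g hg hle (hclose _ _ heq.symm)).symm
  simpa using card_le_card_of_injOn _ hmaps hinj

/-! ### Uniform convergence of the empirical errors -/

lemma err_le_err_add (y : Fin n → Bool) (S : Finset (Fin n)) (h g : Fin n → Bool)
    (E : Finset (Fin n)) (hE : ∀ j, h j ≠ g j → j ∈ E) :
    err y S h ≤ err y S g + (#{j ∈ S | j ∈ E} : ℝ) / #S := by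
  rw [err, err, ← add_div]
  have : #{j ∈ S | h j ≠ y j} ≤ #{j ∈ S | g j ≠ y j} + #{j ∈ S | j ∈ E} := by
    refine (card_le_card fun j hj => ?_).trans (card_union_le _ _)
    simp only [mem_union, mem_filter] at hj ⊢
    by_cases hjE : j ∈ E
    · exact Or.inr ⟨hj.1, hjE⟩
    · have : h j = g j := by
        by_contra hne
        exact hjE (hE j hne)
      exact Or.inl ⟨hj.1, this ▸ hj.2⟩
  have : (#{j ∈ S | h j ≠ y j} : ℝ) ≤ #{j ∈ S | g j ≠ y j} + #{j ∈ S | j ∈ E} := by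
    exact_mod_cast this
  gcongr

lemma err_add_card_eq_div (y : Fin n → Bool) {S : Finset (Fin n)} (hS : S.Nonempty)
    (h : Fin n → Bool) : err y S h + (#{j ∈ S | h j = y j} : ℝ) / #S = 1 := by
  have hS' : (0 : ℝ) < #S := by exact_mod_cast hS.card_pos
  rw [err, ← add_div, div_eq_one_iff_eq hS'.ne', add_comm]
  exact_mod_cast card_filter_add_card_filter_not (s := S) (fun j => h j = y j)

/-- The empirical errors of the members of `A` are uniformly close to the true ones, provided that
`A` has a small cover. -/
lemma randomSubset_uniform_deviation_le (hn : 0 < n) (y : Fin n → Bool)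
    {A₀ A P : Finset (Fin n → Bool)} (hA : A ⊆ A₀) (hA1 : 1 < #A) (hPA : P ⊆ A) {a γ : ℝ}
    (ha : 0 < a) (hγ : 0 < γ) (hγ1 : γ ≤ 1)
    (hcov : ∀ h ∈ A, ∃ p ∈ P,
      (#{j : Fin n | p j ≠ h j} : ℝ) ≤ γ / (4 * disagreementCoeff A₀) * #(DIS A)) :
    (randomSubset a (DIS A)).toOuterMeasure
        {S | ∃ h ∈ A, γ ≤ |err y S h - err y (DIS A) h|} ≤
      ENNReal.ofReal (3 * #P * Real.exp (-(γ ^ 2 * a / 64))) := by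
  have hD := DIS_nonempty hA1
  set D := DIS A
  set θ := disagreementCoeff A₀
  have hD' : (0 : ℝ) < #D := by exact_mod_cast hD.card_pos
  have hθ : 1 ≤ θ := one_le_disagreementCoeff hn (hA1.trans_le (card_le_card hA))
  set s : ℝ := γ / (4 * θ) * #D with hs
  have hs0 : 0 < s := by positivity
  obtain ⟨B, hB⟩ : ∃ B : (Fin n → Bool) → Finset (Fin n → Bool),
      ∀ p g, g ∈ B p ↔ g ∈ A ∧ (#{j : Fin n | p j ≠ g j} : ℝ) ≤ s :=
    ⟨fun p => {g ∈ A | (#{j : Fin n | p j ≠ g j} : ℝ) ≤ s}, fun p g => mem_filter⟩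
  obtain ⟨E, hEB⟩ : ∃ E : (Fin n → Bool) → Finset (Fin n), ∀ p, E p = DIS (B p) :=
    ⟨_, fun _ => rfl⟩
  have hE : ∀ p ∈ P, (#{j ∈ D | j ∈ E p} : ℝ) / #D ≤ γ / 4 := by
    intro p hp
    rw [div_le_iff₀ hD']
    have h1 := card_DIS_le_of_forall hn (hA (hPA hp))
      (fun g hg => hA ((hB p g).1 hg).1) hs0 (fun g hg => ((hB p g).1 hg).2)
    rw [← hEB] at h1
    have h2 : #{j ∈ D | j ∈ E p} ≤ #(E p) := card_le_card fun j hj => (mem_filter.1 hj).2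
    have h3 : (#{j ∈ D | j ∈ E p} : ℝ) ≤ #(E p) := by exact_mod_cast h2
    calc (#{j ∈ D | j ∈ E p} : ℝ) ≤ θ * s := h3.trans h1
      _ = γ / 4 * #D := by rw [hs]; field_simp
  let dev : (Fin n → Prop) → Set (Finset (Fin n)) := fun q =>
    {S | (#{j ∈ D | q j} : ℝ) / #D + γ / 4 ≤ (#{j ∈ S | q j} : ℝ) / #S}
  have hdev : ∀ q, (randomSubset a D).toOuterMeasure (dev q) ≤
      ENNReal.ofReal (Real.exp (-(γ ^ 2 * a / 64))) := by
    intro q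
    refine (randomSubset_deviation_le q ha (γ := γ / 4) (by positivity) (by linarith)).trans_eq ?_
    congr 3
    ring
  -- The allowance γ splits as γ/4 for `p`, γ/2 for the region `E p` in the sample and γ/4 for it in
  -- `D`. A lower deviation of an error is an upper deviation of the frequency of correct labels;
  -- this needs a nonempty sample, hence the support.
  have hsub : {S | ∃ h ∈ A, γ ≤ |err y S h - err y D h|} ∩ (randomSubset a D).support ⊆
      ⋃ p ∈ P, (dev (fun j => p j ≠ y j) ∪ dev (fun j => p j = y j)) ∪ dev (fun j => j ∈ E p) := by
    rintro S ⟨⟨h, hh, hdev⟩, hS⟩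
    have hS := randomSubset_support_nonempty ha hD hS
    obtain ⟨p, hp, hph⟩ := hcov h hh
    refine Set.mem_iUnion₂.2 ⟨p, hp, ?_⟩
    by_contra hnot
    simp only [Set.mem_union, not_or] at hnot
    obtain ⟨⟨h1, h2⟩, h3⟩ := hnot
    simp only [dev, Set.mem_ofPred_eq, not_le] at h1 h2 h3
    have hEp : ∀ j, h j ≠ p j → j ∈ E p := fun j hj =>
      hEB p ▸ mem_DIS ((hB p h).2 ⟨hh, hph⟩) ((hB p p).2 ⟨hPA hp, by simpa using hs0.le⟩) hj
    have hEp' : ∀ j, p j ≠ h j → j ∈ E p := fun j hj => hEp j hj.symm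
    have e1 := err_le_err_add y S h p (E p) hEp
    have e2 := err_le_err_add y S p h (E p) hEp'
    have e3 := err_le_err_add y D h p (E p) hEp
    have e4 := err_le_err_add y D p h (E p) hEp'
    have e5 := hE p hp
    have e6 := err_add_card_eq_div y hS p
    have e7 := err_add_card_eq_div y hD p
    have e8 : err y S p < err y D p + γ / 4 := h1
    refine absurd hdev (not_le.2 (abs_lt.2 ⟨?_, ?_⟩)) <;> linarith
  calc _ ≤ (randomSubset a D).toOuterMeasure (⋃ p ∈ P,
        (dev (fun j => p j ≠ y j) ∪ dev (fun j => p j = y j)) ∪ dev (fun j => j ∈ E p)) :=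
        PMF.toOuterMeasure_mono _ hsub
    _ ≤ ∑ p ∈ P, (randomSubset a D).toOuterMeasure
        ((dev (fun j => p j ≠ y j) ∪ dev (fun j => p j = y j)) ∪ dev (fun j => j ∈ E p)) :=
        MeasureTheory.measure_biUnion_finset_le _ _
    _ ≤ ∑ p ∈ P, (ENNReal.ofReal (Real.exp (-(γ ^ 2 * a / 64))) +
          ENNReal.ofReal (Real.exp (-(γ ^ 2 * a / 64))) +
          ENNReal.ofReal (Real.exp (-(γ ^ 2 * a / 64)))) := by
        refine sum_le_sum fun p _ => (MeasureTheory.measure_union_le _ _).trans ?_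
        exact add_le_add ((MeasureTheory.measure_union_le _ _).trans
          (add_le_add (hdev _) (hdev _))) (hdev _)
    _ = _ := by
        rw [sum_const, nsmul_eq_mul, ← ENNReal.ofReal_add (by positivity) (by positivity),
          ← ENNReal.ofReal_add (by positivity) (by positivity), ← ENNReal.ofReal_natCast,
          ← ENNReal.ofReal_mul (by positivity)]
        congr 1
        ring

/-! ### Calibration of the sample sizes -/

lemma one_le_toNat_vcDim {X : Type*} {x : Fin n → X} {H : Set (X → Bool)}
    (hH : vcDim H ≠ ⊤) (hA : 1 < #(onData x H)) : 1 ≤ (vcDim H).toNat := by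
  obtain ⟨g, hg, g', hg', hne⟩ := one_lt_card.1 hA
  obtain ⟨j, hj⟩ := Function.ne_iff.1 hne
  obtain ⟨h, hh, rfl⟩ := mem_onData.1 hg
  obtain ⟨h', hh', rfl⟩ := mem_onData.1 hg'
  rw [← card_singleton (x j)]
  refine card_le_toNat_vcDim hH fun f => ?_
  simp only [mem_singleton, forall_eq]
  simp only [Function.comp_apply] at hj
  by_cases hf : h (x j) = f (x j)
  · exact ⟨h, hh, hf⟩
  · refine ⟨h', hh', ?_⟩
    revert hf hj
    cases h (x j) <;> cases h' (x j) <;> cases f (x j) <;> simp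

/-- The constant in the sample sizes. -/
def sampleConst : ℝ := 65536 * 40000

/-- A small cover of `A` exists when the sample size is as in the algorithm. -/
lemma exists_cover_log_card_le (hn : 0 < n) {X : Type*} {x : Fin n → X} {H : Set (X → Bool)}
    (hH : vcDim H ≠ ⊤) {A : Finset (Fin n → Bool)} (hA : A ⊆ onData x H) (hA1 : 1 < #A)
    {ε κ : ℝ} (hε : 0 < ε) (hε1 : ε ≤ 1) (hκ : κ = disagreementCoeff (onData x H) / ε) :
    ∃ P ⊆ A, P.Nonempty ∧ (∀ h ∈ A, ∃ p ∈ P, (#{j : Fin n | p j ≠ h j} : ℝ) ≤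
        1 / (32 * κ) / (4 * disagreementCoeff (onData x H)) * #(DIS A)) ∧
      Real.log #P + 3 ≤ 40000 * ((vcDim H).toNat * Real.log κ) + 40000 / κ ^ 2 := by
  have hθ : 1 ≤ disagreementCoeff (onData x H) :=
    one_le_disagreementCoeff hn (hA1.trans_le (card_le_card hA))
  set θ := disagreementCoeff (onData x H)
  have hκ1 : 1 ≤ κ := by rw [hκ, le_div_iff₀ hε]; linarith
  have hθκ : θ ≤ κ := by rw [hκ, le_div_iff₀ hε]; nlinarith
  have hV : (1 : ℝ) ≤ (vcDim H).toNat := by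
    exact_mod_cast one_le_toNat_vcDim hH (hA1.trans_le (card_le_card hA))
  set V : ℝ := ((vcDim H).toNat : ℝ)
  have hlog0 : 0 ≤ Real.log κ := Real.log_nonneg hκ1
  set ρ : ℝ := 1 / (32 * κ) / (4 * θ) with hρ
  have hρ0 : 0 < ρ := by positivity
  have hρeq : ρ = 1 / (128 * (κ * θ)) := by rw [hρ, div_div]; congr 1; ring
  obtain ⟨P, hPA, hsep, hcov⟩ := exists_separated_cover A (s := ρ * #(DIS A)) (by positivity)
  obtain ⟨h₀, hh₀⟩ : A.Nonempty := card_pos.1 (by omega)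
  have hPne : P.Nonempty := let ⟨p, hp, _⟩ := hcov h₀ hh₀; ⟨p, hp⟩
  refine ⟨P, hPA, hPne, hcov, ?_⟩
  -- For κ near 1 only the term 40000/κ², which comes from the additive constant in the sample size,
  -- is available.
  rcases le_total κ (1001 / 1000) with hsmall | hlarge
  · have hρ7 : 7 / 1000 ≤ ρ := by
      rw [hρeq, le_div_iff₀ (by positivity)]
      have : κ * θ ≤ 1001 / 1000 * (1001 / 1000) := by gcongr; linarith
      linarith
    have h1 := card_separated_le_of_coeff_le hn hA hA1 hPA (hθκ.trans hsmall) hρ7 hsep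
    have h2 : Real.log #P ≤ 6 := by
      rw [Real.log_le_iff_le_exp (by exact_mod_cast hPne.card_pos)]
      have h3 : (#P : ℝ) ≤ 201 := by exact_mod_cast h1
      have h4 : (2.7 : ℝ) ^ 6 ≤ Real.exp 1 ^ 6 := by
        gcongr
        have := Real.exp_one_gt_d9
        linarith
      rw [← Real.exp_nat_mul] at h4
      norm_num at h4
      linarith
    have : 0 ≤ V * Real.log κ := by positivity
    have : 9 ≤ 40000 / κ ^ 2 := by
      rw [le_div_iff₀ (by positivity)]
      nlinarith
    linarith
  -- With log κ bounded below and V ≥ 1, absolute constants are absorbed into V·log κ.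
  · have hlog : 1 / 1001 ≤ Real.log κ := by
      have h1 := Real.one_sub_inv_le_log_of_pos (show 0 < κ by linarith)
      have h2 : κ⁻¹ ≤ (1001 / 1000)⁻¹ := inv_anti₀ (by norm_num) hlarge
      norm_num at h2
      linarith
    have hρ1 : ρ ≤ 1 := by
      rw [hρeq, div_le_one (by positivity)]
      nlinarith
    have h1 := log_card_separated_le hH hA hA1 hPA hPne hρ0 hρ1 hsep
    have h2 : Real.log (4 / ρ) ≤ 7 + 2 * Real.log κ := by
      have h3 : 4 / ρ ≤ 2 ^ 9 * κ ^ 2 := by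
        rw [hρeq, div_div_eq_mul_div, div_one]
        nlinarith
      refine (Real.log_le_log (by positivity) h3).trans ?_
      rw [Real.log_mul (by positivity) (by positivity), Real.log_pow, Real.log_pow]
      have := Real.log_two_lt_d9
      push_cast
      linarith
    have h3 : 1 ≤ V * (1001 * Real.log κ) := by nlinarith
    have h4 : 2 * V * Real.log (4 / ρ) ≤ 2 * V * (7 * (1001 * Real.log κ) + 2 * Real.log κ) := by
      gcongr
      linarith
    have : 0 ≤ 40000 / κ ^ 2 := by positivity
    linarith

/-- The confidence guarantee of a single draw of the algorithm. -/
lemma randomSubset_uniform_deviation_le_confidence (hn : 0 < n) {X : Type*} {x : Fin n → X}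
    (y : Fin n → Bool) {H : Set (X → Bool)} (hH : vcDim H ≠ ⊤) {A : Finset (Fin n → Bool)}
    (hA : A ⊆ onData x H) (hA1 : 1 < #A) {ε d : ℝ} (hε : 0 < ε) (hε1 : ε ≤ 1) (hd : 0 < d)
    (hd1 : d ≤ 1) :
    (randomSubset (sampleConst * disagreementCoeff (onData x H) ^ 2 / ε ^ 2 *
        ((vcDim H).toNat * Real.log (disagreementCoeff (onData x H) / ε) + Real.log (1 / d)) +
          sampleConst) (DIS A)).toOuterMeasure
        {S | ∃ h ∈ A, ε / (32 * disagreementCoeff (onData x H)) ≤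
          |err y S h - err y (DIS A) h|} ≤ ENNReal.ofReal (d / 2) := by
  have hθ : 1 ≤ disagreementCoeff (onData x H) :=
    one_le_disagreementCoeff hn (hA1.trans_le (card_le_card hA))
  set θ := disagreementCoeff (onData x H) with hθdef
  have hV : (1 : ℝ) ≤ (vcDim H).toNat := by
    exact_mod_cast one_le_toNat_vcDim hH (hA1.trans_le (card_le_card hA))
  obtain ⟨κ, hκ⟩ : ∃ κ, κ = θ / ε := ⟨_, rfl⟩
  have hκ1 : 1 ≤ κ := by rw [hκ, le_div_iff₀ hε]; linarith
  obtain ⟨P, hPA, hPne, hcov, hlogP⟩ := exists_cover_log_card_le hn hH hA hA1 hε hε1 hκ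
  have hlog0 : 0 ≤ Real.log κ := Real.log_nonneg hκ1
  have hlogd : 0 ≤ Real.log (1 / d) := Real.log_nonneg (by rw [le_div_iff₀ hd]; linarith)
  have hγ : ε / (32 * θ) = 1 / (32 * κ) := by rw [hκ]; field_simp
  have hc : sampleConst * θ ^ 2 / ε ^ 2 = sampleConst * κ ^ 2 := by rw [hκ, div_pow, mul_div_assoc]
  rw [hγ, hc, ← hκ]
  set V : ℝ := ((vcDim H).toNat : ℝ)
  set a := sampleConst * κ ^ 2 * (V * Real.log κ + Real.log (1 / d)) + sampleConst with ha
  have hK : 0 < sampleConst := by norm_num [sampleConst]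
  have ha0 : 0 < a := by positivity
  refine (randomSubset_uniform_deviation_le hn y hA hA1 hPA ha0 (by positivity)
    (by rw [div_le_one (by positivity)]; linarith) hcov).trans (ENNReal.ofReal_le_ofReal ?_)
  have hP0 : (0 : ℝ) < #P := by exact_mod_cast hPne.card_pos
  have hexp : Real.log #P + 2 + Real.log (1 / d) ≤ (1 / (32 * κ)) ^ 2 * a / 64 := by
    -- The factor 65536 = 64·32² of `sampleConst` cancels here.
    have h3 : (1 / (32 * κ)) ^ 2 * a / 64 =
        40000 * (V * Real.log κ + Real.log (1 / d)) + 40000 / κ ^ 2 := by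
      rw [ha, sampleConst]
      field_simp
      ring
    rw [h3]
    linarith
  have h1 : (6 : ℝ) ≤ Real.exp 2 := by
    have h4 : (2.5 : ℝ) ^ 2 ≤ Real.exp 1 ^ 2 := by
      gcongr
      have := Real.exp_one_gt_d9
      linarith
    rw [← Real.exp_nat_mul] at h4
    norm_num at h4
    linarith
  have h2 : Real.exp (-((1 / (32 * κ)) ^ 2 * a / 64)) ≤ d / (#P * Real.exp 2) := by
    calc Real.exp (-((1 / (32 * κ)) ^ 2 * a / 64))
        ≤ Real.exp (-(Real.log #P + 2 + Real.log (1 / d))) := by gcongr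
      _ = d / (#P * Real.exp 2) := by
        rw [Real.exp_neg, Real.exp_add, Real.exp_add, Real.exp_log hP0,
          Real.exp_log (by positivity)]
        field_simp
  calc 3 * #P * Real.exp (-((1 / (32 * κ)) ^ 2 * a / 64))
      ≤ 3 * #P * (d / (#P * Real.exp 2)) := by gcongr
    _ = 3 * d / Real.exp 2 := by field_simp
    _ ≤ 3 * d / 6 := by gcongr
    _ = d / 2 := by ring

/-! ### The radius -/

lemma exists_radius_mem {A : Finset (Fin n → Bool)} (hA : A.Nonempty) :
    {r : ℝ | ∃ h ∈ A, A ⊆ ball A h r}.Nonempty := by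
  obtain ⟨h, hh⟩ := hA
  refine ⟨1, h, hh, fun g hg => mem_filter.2 ⟨hg, ?_⟩⟩
  refine div_le_one_of_le₀ ?_ (by positivity)
  exact_mod_cast (card_le_univ _).trans_eq (Fintype.card_fin n)

lemma radius_le {A : Finset (Fin n → Bool)} {h : Fin n → Bool} (hh : h ∈ A) {r : ℝ}
    (hr : ∀ g ∈ A, distance h g ≤ r) : radius A ≤ r := by
  refine csInf_le ⟨0, ?_⟩ ⟨h, hh, fun g hg => mem_filter.2 ⟨hg, hr g hg⟩⟩
  rintro s ⟨g, hg, hs⟩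
  have := (mem_filter.1 (hs hg)).2
  exact le_trans (by unfold distance; positivity) this

lemma radius_le_one {A : Finset (Fin n → Bool)} (hA : A.Nonempty) : radius A ≤ 1 := by
  obtain ⟨h, hh⟩ := hA
  refine radius_le hh fun g _ => div_le_one_of_le₀ ?_ (by positivity)
  exact_mod_cast (card_le_univ _).trans_eq (Fintype.card_fin n)

lemma one_le_mul_of_subset_ball (hn : 0 < n) {A : Finset (Fin n → Bool)}
    (hA : 1 < #A) {h : Fin n → Bool} {r : ℝ} (hr : A ⊆ ball A h r) : 1 ≤ r * n := by
  obtain ⟨g, hg, hne⟩ := exists_mem_ne hA h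
  have h1 := (mem_filter.1 (hr hg)).2
  have h2 : (1 : ℝ) ≤ distance h g * n := by
    rw [mul_distance hn]
    exact_mod_cast card_disagreement_pos hne.symm
  exact h2.trans (by gcongr)

/-- Distances are multiples of 1/n; this forces termination once the radius falls below 1/n. -/
lemma one_le_radius_mul (hn : 0 < n) {A : Finset (Fin n → Bool)} (hA : 1 < #A) :
    1 ≤ radius A * n := by
  have hn' : (0 : ℝ) < n := by exact_mod_cast hn
  rw [← div_le_iff₀ hn']
  refine le_csInf (exists_radius_mem (card_pos.1 (by omega))) ?_
  rintro r ⟨h, -, hr⟩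
  rw [div_le_iff₀ hn']
  exact one_le_mul_of_subset_ball hn hA hr

lemma card_DIS_le_radius (hn : 0 < n) {A₀ A : Finset (Fin n → Bool)} (hA : A ⊆ A₀)
    (hA1 : 1 < #A) : (#(DIS A) : ℝ) ≤ disagreementCoeff A₀ * radius A * n := by
  have hn' : (0 : ℝ) < n := by exact_mod_cast hn
  have hθ : 1 ≤ disagreementCoeff A₀ :=
    one_le_disagreementCoeff hn (hA1.trans_le (card_le_card hA))
  have hθn : 0 < disagreementCoeff A₀ * n := by positivity
  have : (#(DIS A) : ℝ) / (disagreementCoeff A₀ * n) ≤ radius A := by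
    refine le_csInf (exists_radius_mem (card_pos.1 (by omega))) ?_
    rintro r ⟨h, hh, hr⟩
    rw [div_le_iff₀ hθn]
    have h1 := one_le_mul_of_subset_ball hn hA1 hr
    have h2 := card_DIS_le_of_forall hn (hA hh) hA (s := r * n) (by linarith) (fun g hg => by
      rw [← mul_distance hn]
      have := (mem_filter.1 (hr hg)).2
      gcongr)
    linarith
  rw [div_le_iff₀ hθn] at this
  linarith

/-! ### Errors on the disagreement region -/

lemma err_mul_card {S : Finset (Fin n)} (hS : S.Nonempty) (y h : Fin n → Bool) :
    err y S h * #S = #{j ∈ S | h j ≠ y j} := by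
  have : (#S : ℝ) ≠ 0 := by exact_mod_cast hS.card_pos.ne'
  rw [err, div_mul_cancel₀ _ this]

lemma err_univ_mul (hn : 0 < n) (y h : Fin n → Bool) :
    err y univ h * n = #{j : Fin n | h j ≠ y j} := by
  have := err_mul_card (S := univ) ⟨⟨0, hn⟩, mem_univ _⟩ y h
  simpa using this

lemma err_nonneg (y : Fin n → Bool) (S : Finset (Fin n)) (h : Fin n → Bool) : 0 ≤ err y S h := by
  unfold err; positivity

/-- Members of `A` make the same mistakes outside the disagreement region of `A`. -/
lemma err_univ_sub_mul (hn : 0 < n) (y : Fin n → Bool) {A : Finset (Fin n → Bool)} (hA : 1 < #A)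
    {g h : Fin n → Bool} (hg : g ∈ A) (hh : h ∈ A) :
    (err y univ h - err y univ g) * n = (err y (DIS A) h - err y (DIS A) g) * #(DIS A) := by
  have hD := DIS_nonempty hA
  have hsplit : ∀ k : Fin n → Bool, (#{j : Fin n | k j ≠ y j} : ℝ) =
      #{j ∈ DIS A | k j ≠ y j} + #{j ∈ (DIS A)ᶜ | k j ≠ y j} := by
    intro k
    rw [← Nat.cast_add, ← card_union_of_disjoint
      (disjoint_filter_filter disjoint_compl_right), ← filter_union, union_compl]
  have hout : ({j ∈ (DIS A)ᶜ | h j ≠ y j} : Finset (Fin n)) = {j ∈ (DIS A)ᶜ | g j ≠ y j} := by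
    refine filter_congr fun j hj => ?_
    have : h j = g j := by
      by_contra hne
      exact (mem_compl.1 hj) (mem_DIS hh hg hne)
    rw [this]
  rw [sub_mul, sub_mul, err_univ_mul hn, err_univ_mul hn, err_mul_card hD, err_mul_card hD,
    hsplit h, hsplit g, hout]
  ring

lemma err_DIS_mul_le (hn : 0 < n) (y : Fin n → Bool) {A : Finset (Fin n → Bool)} (hA : 1 < #A)
    (h : Fin n → Bool) : err y (DIS A) h * #(DIS A) ≤ err y univ h * n := by
  rw [err_univ_mul hn, err_mul_card (DIS_nonempty hA)]
  exact_mod_cast card_le_card (filter_subset_filter _ (subset_univ _))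

lemma err_DIS_le_of_err_univ_le (hn : 0 < n) (y : Fin n → Bool) {A : Finset (Fin n → Bool)}
    (hA : 1 < #A) {g h : Fin n → Bool} (hg : g ∈ A) (hh : h ∈ A)
    (hle : err y univ g ≤ err y univ h) : err y (DIS A) g ≤ err y (DIS A) h := by
  have h1 := err_univ_sub_mul hn y hA hg hh
  have hD : (0 : ℝ) < #(DIS A) := by exact_mod_cast (DIS_nonempty hA).card_pos
  have h2 : 0 ≤ (err y univ h - err y univ g) * n := mul_nonneg (by linarith) (by positivity)
  rw [h1] at h2
  have := nonneg_of_mul_nonneg_left h2 hD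
  linarith

/-- Wherever two classifiers differ, one of them is wrong; this turns small errors into small
distances. -/
lemma distance_mul_le (hn : 0 < n) (y : Fin n → Bool) {A : Finset (Fin n → Bool)} (hA : 1 < #A)
    {g h : Fin n → Bool} (hg : g ∈ A) (hh : h ∈ A) :
    distance g h * n ≤ (err y (DIS A) g + err y (DIS A) h) * #(DIS A) := by
  rw [mul_distance hn, add_mul, err_mul_card (DIS_nonempty hA), err_mul_card (DIS_nonempty hA),
    disagreement_eq_filter_DIS hg hh]
  have : #{j ∈ DIS A | g j ≠ h j} ≤ #{j ∈ DIS A | g j ≠ y j} + #{j ∈ DIS A | h j ≠ y j} := by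
    refine (card_le_card fun j hj => ?_).trans (card_union_le _ _)
    simp only [mem_union, mem_filter] at hj ⊢
    by_cases hgy : g j = y j
    · exact Or.inr ⟨hj.1, fun hhy => hj.2 (hgy.trans hhy.symm)⟩
    · exact Or.inl ⟨hj.1, hgy⟩
  exact_mod_cast this

/-! ### One iteration on a representative sample -/

/-- Optimality on the whole data set passes to DIS(A), where the true errors lie inside the
confidence intervals. -/
lemma mem_prune_of_deviation_lt (hn : 0 < n) (y : Fin n → Bool) {A : Finset (Fin n → Bool)}
    (hA : 1 < #A) {S : Finset (Fin n)} {w : ℝ}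
    (hS : ∀ h ∈ A, |err y S h - err y (DIS A) h| < w / 2) {g : Fin n → Bool} (hg : g ∈ A)
    (hopt : ∀ h ∈ A, err y univ g ≤ err y univ h) : g ∈ prune y w S A := by
  refine mem_filter.2 ⟨hg, le_csInf ⟨_, g, hg, rfl⟩ ?_⟩
  rintro _ ⟨h, hh, rfl⟩
  have h1 := abs_lt.1 (hS g hg)
  have h2 := abs_lt.1 (hS h hh)
  have h3 := err_DIS_le_of_err_univ_le hn y hA hg hh (hopt h hh)
  rw [LB, UB]
  linarith

lemma radius_prune_le (hn : 0 < n) (y : Fin n → Bool) {A₀ A : Finset (Fin n → Bool)}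
    (hAA : A ⊆ A₀) (hA : 1 < #A) {S : Finset (Fin n)} {w : ℝ}
    (hw : w = 1 / (16 * disagreementCoeff A₀))
    (hS : ∀ h ∈ A, |err y S h - err y (DIS A) h| < w / 2) {g : Fin n → Bool} (hg : g ∈ A)
    (hopt : ∀ h ∈ A, err y univ g ≤ err y univ h) :
    radius (prune y w S A) ≤ 2 * err y univ g + radius A / 8 := by
  have hn' : (0 : ℝ) < n := by exact_mod_cast hn
  have hθ : 1 ≤ disagreementCoeff A₀ :=
    one_le_disagreementCoeff hn (hA.trans_le (card_le_card hAA))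
  refine radius_le (mem_prune_of_deviation_lt hn y hA hS hg hopt) fun h hh => ?_
  obtain ⟨hhA, hLB⟩ := mem_filter.1 hh
  have hUB : sInf (UB y w S '' (A : Set (Fin n → Bool))) ≤ UB y w S g :=
    csInf_le (A.finite_toSet.image _).bddBelow ⟨g, hg, rfl⟩
  have h0 := hLB.trans hUB
  rw [LB, UB] at h0
  have h1 := abs_lt.1 (hS g hg)
  have h2 := abs_lt.1 (hS h hhA)
  have h3 : err y (DIS A) h ≤ err y (DIS A) g + 2 * w := by linarith
  have h4 := distance_mul_le hn y hA hg hhA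
  have h5 := err_DIS_mul_le hn y hA g
  have h6 := card_DIS_le_radius hn hAA hA
  have h7 : w * #(DIS A) ≤ radius A * n / 16 := by
    rw [hw]
    calc _ ≤ 1 / (16 * disagreementCoeff A₀) * (disagreementCoeff A₀ * radius A * n) := by gcongr
      _ = _ := by field_simp
  have h8 : (err y (DIS A) g + err y (DIS A) h) * #(DIS A) ≤
      (2 * err y (DIS A) g + 2 * w) * #(DIS A) :=
    mul_le_mul_of_nonneg_right (by linarith) (Nat.cast_nonneg _)
  refine le_of_mul_le_mul_right ?_ hn'
  nlinarith

/-- All intervals have the same width, so the minimizer of `UB` minimizes the empirical error. Its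
excess on DIS(A) is at most w, and |DIS A|/n ≤ θ·radius(A) scales this down. -/
lemma err_univ_le_of_mem_argminUB (hn : 0 < n) (y : Fin n → Bool) {A₀ A : Finset (Fin n → Bool)}
    (hAA : A ⊆ A₀) (hA : 1 < #A) {S : Finset (Fin n)} {ε w : ℝ} (hε : 0 < ε)
    (hw : w = ε / (16 * disagreementCoeff A₀))
    (hS : ∀ h ∈ A, |err y S h - err y (DIS A) h| < w / 2) {g h : Fin n → Bool} (hg : g ∈ A)
    (hh : h ∈ argminUB y w S A) : err y univ h ≤ err y univ g + ε * radius A / 16 := by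
  have hn' : (0 : ℝ) < n := by exact_mod_cast hn
  have hθ : 1 ≤ disagreementCoeff A₀ :=
    one_le_disagreementCoeff hn (hA.trans_le (card_le_card hAA))
  obtain ⟨hhA, hmin⟩ := mem_filter.1 hh
  have h0 := hmin g hg
  rw [UB, UB] at h0
  have h1 := abs_lt.1 (hS g hg)
  have h2 := abs_lt.1 (hS h hhA)
  have h3 : err y (DIS A) h - err y (DIS A) g ≤ w := by linarith
  have h4 := err_univ_sub_mul hn y hA hg hhA
  have h6 := card_DIS_le_radius hn hAA hA
  have h7 : (err y (DIS A) h - err y (DIS A) g) * #(DIS A) ≤ ε * radius A / 16 * n := by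
    calc _ ≤ w * (disagreementCoeff A₀ * radius A * n) := by
          have : 0 ≤ w := by rw [hw]; positivity
          gcongr
      _ = _ := by rw [hw]; field_simp
  rw [← h4] at h7
  have := le_of_mul_le_mul_right h7 hn'
  linarith

lemma argminUB_nonempty (y : Fin n → Bool) (w : ℝ) (S : Finset (Fin n))
    {A : Finset (Fin n → Bool)} (hA : A.Nonempty) : (argminUB y w S A).Nonempty := by
  obtain ⟨h, hh, hmin⟩ := exists_min_image A (UB y w S) hA
  exact ⟨h, mem_filter.2 ⟨hh, hmin⟩⟩

/-! ### Failure probability of the algorithm -/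

lemma toOuterMeasure_le_one {α : Type*} (p : PMF α) (s : Set α) : p.toOuterMeasure s ≤ 1 := by
  calc p.toOuterMeasure s ≤ p.toOuterMeasure Set.univ := by
        gcongr
        exact Set.subset_univ s
    _ = 1 := (p.toOuterMeasure_apply_eq_one_iff _).2 (Set.subset_univ _)

/-- Union bound over two stages: `B` is the set of unrepresentative first draws. -/
lemma toOuterMeasure_bind_le {α β : Type*} (p : PMF α) (f : α → PMF β) (s : Set β) (B : Set α)
    {c d : ENNReal} (hB : p.toOuterMeasure B ≤ c)
    (hf : ∀ a, a ∉ B → (f a).toOuterMeasure s ≤ d) : (p.bind f).toOuterMeasure s ≤ c + d := by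
  rw [PMF.toOuterMeasure_bind_apply]
  calc ∑' a, p a * (f a).toOuterMeasure s ≤ ∑' a, (B.indicator p a + p a * d) := by
        refine ENNReal.tsum_le_tsum fun a => ?_
        by_cases ha : a ∈ B
        · rw [Set.indicator_of_mem ha]
          calc p a * (f a).toOuterMeasure s ≤ p a * 1 := by
                gcongr
                exact toOuterMeasure_le_one _ _
            _ ≤ _ := by rw [mul_one]; exact le_self_add
        · rw [Set.indicator_of_notMem ha, zero_add]
          gcongr
          exact hf a ha
    _ = p.toOuterMeasure B + d := by
        rw [ENNReal.tsum_add, ENNReal.tsum_mul_right, PMF.tsum_coe, one_mul,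
          PMF.toOuterMeasure_apply]
    _ ≤ c + d := by gcongr

lemma toOuterMeasure_pure_compl {α : Type*} {a : α} {s : Set α} (h : a ∈ s) :
    (PMF.pure a).toOuterMeasure sᶜ = 0 := by
  rw [PMF.toOuterMeasure_pure_apply, if_neg (by simpa using h)]

/-- The acceptable outputs for the optimal error `η`. -/
def nearOptimal (y : Fin n → Bool) (A : Finset (Fin n → Bool)) (η ε : ℝ) :
    Set (Option (Fin n → Bool)) :=
  {o | ∃ g ∈ A, o = some g ∧ (err y univ g < η * (1 + ε) ∨ err y univ g = 0 ∧ η = 0)}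

lemma some_mem_nearOptimal (y : Fin n → Bool) {A : Finset (Fin n → Bool)} {g : Fin n → Bool}
    (hg : g ∈ A) {ε : ℝ} (hε : 0 < ε) : some g ∈ nearOptimal y A (err y univ g) ε := by
  refine ⟨g, hg, rfl, ?_⟩
  rcases (err_nonneg y univ g).eq_or_lt with h | h
  · exact Or.inr ⟨h.symm, h.symm⟩
  · exact Or.inl (by nlinarith)

lemma mainLoop_of_card_le_one (P : Params) (y : Fin n → Bool)
    {tie : Finset (Fin n → Bool) → (Fin n → Bool)} (htie : ∀ A, A.Nonempty → tie A ∈ A) (T : ℕ)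
    {A : Finset (Fin n → Bool)} {g : Fin n → Bool} (hg : g ∈ A) (hA : ¬ 1 < #A) (r : ℝ) :
    mainLoop P y tie T A r = PMF.pure (some g) := by
  have : tie A = g := card_le_one.1 (not_lt.1 hA) _ (htie A ⟨g, hg⟩) _ hg
  cases T <;> rw [mainLoop, if_neg hA, this]

section

variable {X : Type*} {x : Fin n → X} {y : Fin n → Bool} {H : Set (X → Bool)}
  {tie : Finset (Fin n → Bool) → (Fin n → Bool)} {P : Params}

/-- The parameters are those of the algorithm for `H`. -/
structure IsAdmissible (P : Params) (x : Fin n → X) (H : Set (X → Bool)) : Prop where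
  c₁_eq : P.c₁ = sampleConst
  c₂_eq : P.c₂ = sampleConst
  b₁_eq : P.b₁ = sampleConst
  b₂_eq : P.b₂ = sampleConst
  θ_eq : P.θ = disagreementCoeff (onData x H)
  V_eq : P.V = (vcDim H).toNat
  ε_pos : 0 < P.ε
  ε_le : P.ε ≤ 1
  δ_pos : 0 < P.δ
  δ_lt : P.δ < 1

lemma directEstimation_failure_le (hn : 0 < n) (hH : vcDim H ≠ ⊤)
    (htie : ∀ A, A.Nonempty → tie A ∈ A) (hP : IsAdmissible P x H)
    {A : Finset (Fin n → Bool)} (hA : A ⊆ onData x H) (hA1 : 1 < #A) {g : Fin n → Bool}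
    (hg : g ∈ A) (hη : 3 / 16 * radius A < err y univ g) :
    (directEstimation P y tie A).toOuterMeasure
      (nearOptimal y (onData x H) (err y univ g) P.ε)ᶜ ≤ ENNReal.ofReal (P.δ / 2) := by
  have hdev := randomSubset_uniform_deviation_le_confidence hn y hH hA hA1 hP.ε_pos hP.ε_le
    hP.δ_pos hP.δ_lt.le
  have hsize : P.finalSize = sampleConst * disagreementCoeff (onData x H) ^ 2 / P.ε ^ 2 *
      ((vcDim H).toNat * Real.log (disagreementCoeff (onData x H) / P.ε) + Real.log (1 / P.δ)) +
        sampleConst := by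
    rw [Params.finalSize, hP.c₂_eq, hP.b₂_eq, hP.θ_eq, hP.V_eq]
  have hw : P.finalWidth = P.ε / (16 * disagreementCoeff (onData x H)) := by
    rw [Params.finalWidth, hP.θ_eq]
  rw [← hsize] at hdev
  rw [directEstimation, ← add_zero (ENNReal.ofReal (P.δ / 2))]
  refine toOuterMeasure_bind_le _ _ _ _ hdev fun S hS => le_of_eq ?_
  simp only [Set.mem_ofPred_eq, not_exists, not_and, not_le] at hS
  have hS' : ∀ h ∈ A, |err y S h - err y (DIS A) h| < P.finalWidth / 2 := by
    intro h hh
    refine (hS h hh).trans_eq ?_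
    rw [hw, div_div]
    congr 1
    ring
  have hmem := htie _ (argminUB_nonempty y P.finalWidth S ⟨g, hg⟩)
  have hle := err_univ_le_of_mem_argminUB hn y hA hA1 hP.ε_pos hw hS' hg hmem
  have hr : 0 < radius A := by
    have h1 := one_le_radius_mul hn hA1
    exact pos_of_mul_pos_left (by linarith) (Nat.cast_nonneg n)
  refine toOuterMeasure_pure_compl ⟨_, hA (mem_filter.1 hmem).1, rfl, Or.inl ?_⟩
  -- By `hη`, the excess ε·radius(A)/16 is below εη/3.
  have := hP.ε_pos
  nlinarith

/-- Here k bounds the halvings still possible. Each iteration costs δ'/2, and direct estimation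
costs δ/2 at most once, as it ends the run. The measure `r` need only dominate the radius, since it
starts at 1. -/
lemma mainLoop_failure_le (hn : 0 < n) (hH : vcDim H ≠ ⊤)
    (htie : ∀ A, A.Nonempty → tie A ∈ A) (hP : IsAdmissible P x H)
    (hδ' : 0 < P.δ' n) (hδ'1 : P.δ' n ≤ 1) {g : Fin n → Bool}
    (hopt : ∀ h ∈ onData x H, err y univ g ≤ err y univ h) (k : ℕ) :
    ∀ (T : ℕ) (A : Finset (Fin n → Bool)) (r : ℝ), k ≤ T → A ⊆ onData x H → g ∈ A →
      radius A ≤ r → r * n < 2 ^ k →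
      (mainLoop P y tie T A r).toOuterMeasure
        (nearOptimal y (onData x H) (err y univ g) P.ε)ᶜ ≤
          ENNReal.ofReal (k * (P.δ' n / 2) + P.δ / 2) := by
  have hn' : (0 : ℝ) < n := by exact_mod_cast hn
  have hδ := hP.δ_pos
  induction k with
  | zero =>
    intro T A r _ hA hg hr hrn
    have hA1 : ¬ 1 < #A := by
      intro hA1
      have h1 := one_le_radius_mul hn hA1
      have h2 : radius A * n ≤ r * n := by gcongr
      rw [pow_zero] at hrn
      linarith
    rw [mainLoop_of_card_le_one P y htie T hg hA1,
      toOuterMeasure_pure_compl (some_mem_nearOptimal y (hA hg) hP.ε_pos)]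
    exact zero_le
  | succ k ih =>
    intro T A r hT hA hg hr hrn
    by_cases hA1 : 1 < #A
    swap
    · rw [mainLoop_of_card_le_one P y htie T hg hA1,
        toOuterMeasure_pure_compl (some_mem_nearOptimal y (hA hg) hP.ε_pos)]
      exact zero_le
    obtain ⟨T, rfl⟩ : ∃ T', T = T' + 1 := ⟨T - 1, by omega⟩
    -- A loop sample is a direct estimation sample with ε = 1 and confidence δ'.
    have hdev := randomSubset_uniform_deviation_le_confidence hn y hH hA hA1 one_pos le_rfl
      hδ' hδ'1
    have hsize : P.loopSize n = sampleConst * disagreementCoeff (onData x H) ^ 2 / 1 ^ 2 *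
        ((vcDim H).toNat * Real.log (disagreementCoeff (onData x H) / 1) +
          Real.log (1 / P.δ' n)) + sampleConst := by
      rw [Params.loopSize, hP.c₁_eq, hP.b₁_eq, hP.θ_eq, hP.V_eq, one_pow, div_one, div_one]
    have hw : P.loopWidth = 1 / (16 * disagreementCoeff (onData x H)) := by
      rw [Params.loopWidth, hP.θ_eq]
    rw [← hsize] at hdev
    rw [mainLoop, if_pos hA1]
    have hsplit : ENNReal.ofReal (((k + 1 : ℕ) : ℝ) * (P.δ' n / 2) + P.δ / 2) =
        ENNReal.ofReal (P.δ' n / 2) + ENNReal.ofReal (k * (P.δ' n / 2) + P.δ / 2) := by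
      rw [← ENNReal.ofReal_add (by positivity) (by positivity)]
      congr 1
      push_cast
      ring
    rw [hsplit]
    refine toOuterMeasure_bind_le _ _ _ _ hdev fun S hS => ?_
    simp only [Set.mem_ofPred_eq, not_exists, not_and, not_le] at hS
    have hS' : ∀ h ∈ A, |err y S h - err y (DIS A) h| < P.loopWidth / 2 := by
      intro h hh
      refine (hS h hh).trans_eq ?_
      rw [hw, div_div]
      congr 1
      ring
    have hoptA : ∀ h ∈ A, err y univ g ≤ err y univ h := fun h hh => hopt h (hA hh)
    split_ifs with hrad
    -- Failure to halve gives radius(A)/2 ≤ r/2 < 2η + radius(A)/8, that is η > (3/16)·radius(A).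
    · have h1 := radius_prune_le hn y hA hA1 hw hS' hg hoptA
      refine (directEstimation_failure_le hn hH htie hP hA hA1 hg (by linarith)).trans
        (ENNReal.ofReal_le_ofReal ?_)
      have : 0 ≤ (k : ℝ) * (P.δ' n / 2) := by positivity
      linarith
    · refine ih T _ _ (by omega) ((filter_subset _ _).trans hA)
        (mem_prune_of_deviation_lt hn y hA1 hS' hg hoptA) le_rfl ?_
      rw [not_lt] at hrad
      have h1 : radius (prune y P.loopWidth S A) * n ≤ r / 2 * n := by gcongr
      rw [pow_succ] at hrn
      linarith

end

/-! ### Assembly of the guarantee -/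

lemma exists_optimal {X : Type*} (x : Fin n → X) (y : Fin n → Bool) {H : Set (X → Bool)}
    (hH : H.Nonempty) : ∃ g ∈ onData x H, err y univ g = optimalError x y H ∧
      ∀ h ∈ onData x H, err y univ g ≤ err y univ h := by
  obtain ⟨h₀, hh₀⟩ := hH
  obtain ⟨g, hg, hmin⟩ := exists_min_image (onData x H) (err y univ)
    ⟨h₀ ∘ x, mem_onData.2 ⟨h₀, hh₀, rfl⟩⟩
  refine ⟨g, hg, ?_, hmin⟩
  obtain ⟨h, hh, rfl⟩ := mem_onData.1 hg
  refine le_antisymm (le_csInf ⟨_, h, hh, rfl⟩ ?_) (csInf_le ⟨0, ?_⟩ ⟨h, hh, rfl⟩)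
  · rintro _ ⟨h', hh', rfl⟩
    exact hmin _ (mem_onData.2 ⟨h', hh', rfl⟩)
  · rintro _ ⟨h', -, rfl⟩
    exact err_nonneg _ _ _

lemma algorithm_failure_le {X : Type*} {x : Fin n → X} {y : Fin n → Bool} {H : Set (X → Bool)}
    (hH : vcDim H ≠ ⊤) {tie : Finset (Fin n → Bool) → (Fin n → Bool)}
    (htie : ∀ A, A.Nonempty → tie A ∈ A) {ε δ : ℝ} (hε : 0 < ε) (hε1 : ε ≤ 1) (hδ : 0 < δ)
    (hδ1 : δ < 1) {T : ℕ} (hT : Real.logb 2 (2 * n) ≤ T) {g : Fin n → Bool}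
    (hg : g ∈ onData x H) (hopt : ∀ h ∈ onData x H, err y univ g ≤ err y univ h) :
    (algorithm sampleConst sampleConst sampleConst sampleConst ε δ x y H tie T).toOuterMeasure
      (nearOptimal y (onData x H) (err y univ g) ε)ᶜ ≤ ENNReal.ofReal δ := by
  rw [algorithm]
  -- Without data points all classifiers coincide and the loop returns at once; δ' is meaningless in
  -- this case.
  rcases Nat.eq_zero_or_pos n with rfl | hn
  · have hA1 : ¬ 1 < #(onData x H) := by
      rw [not_lt, card_le_one]
      exact fun a _ b _ => Subsingleton.elim a b
    rw [mainLoop_of_card_le_one _ y htie T hg hA1,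
      toOuterMeasure_pure_compl (some_mem_nearOptimal y hg hε)]
    exact zero_le
  · set P : Params := ⟨sampleConst, sampleConst, sampleConst, sampleConst,
      disagreementCoeff (onData x H), (vcDim H).toNat, ε, δ⟩
    have hP : IsAdmissible P x H := ⟨rfl, rfl, rfl, rfl, rfl, rfl, hε, hε1, hδ, hδ1⟩
    have hn' : (1 : ℝ) ≤ n := by exact_mod_cast hn
    have hlog : 1 ≤ Real.logb 2 (2 * n) := by
      rw [Real.le_logb_iff_rpow_le (by norm_num) (by positivity), Real.rpow_one]
      linarith
    have hδ'eq : P.δ' n * Real.logb 2 (2 * n) = δ / 2 := by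
      rw [Params.δ']
      change δ / (2 * Real.logb 2 (2 * n)) * Real.logb 2 (2 * n) = δ / 2
      field_simp
    have hδ' : 0 < P.δ' n := by
      rw [Params.δ']
      exact div_pos hδ (by positivity)
    have hδ'1 : P.δ' n ≤ 1 := by nlinarith
    -- The factor 2 in log₂(2n) makes the floor suffice: 2n < 2^(k+1) gives n < 2^k.
    set k := ⌊Real.logb 2 (2 * n)⌋₊ with hk
    have hkle : (k : ℝ) ≤ Real.logb 2 (2 * n) := Nat.floor_le (by linarith)
    have hkT : k ≤ T := by exact_mod_cast hkle.trans hT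
    have hnk : 1 * (n : ℝ) < 2 ^ k := by
      have h1 := Nat.lt_floor_add_one (Real.logb 2 (2 * n))
      rw [← hk, Real.logb_lt_iff_lt_rpow (by norm_num) (by positivity)] at h1
      have h2 : (2 : ℝ) ^ ((k : ℝ) + 1) = 2 ^ k * 2 := by
        rw [Real.rpow_add (by norm_num), Real.rpow_natCast, Real.rpow_one]
      linarith
    refine (mainLoop_failure_le hn hH htie hP hδ' hδ'1 hopt k T (onData x H) 1 hkT
      (Subset.refl _) hg (radius_le_one ⟨g, hg⟩) hnk).trans (ENNReal.ofReal_le_ofReal ?_)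
    -- The loop costs at most δ/4, so the total failure probability is at most 3δ/4.
    have h1 : k * P.δ' n ≤ Real.logb 2 (2 * n) * P.δ' n := by gcongr
    change k * (P.δ' n / 2) + δ / 2 ≤ δ
    linarith

end ActiveLearning

end

theorem mainTheorem4 :
    ∃ c₁ c₂ b₁ b₂ : ℝ, 0 < c₁ ∧ 0 < c₂ ∧ 0 < b₁ ∧ 0 < b₂ ∧
      ∀ (X : Type*) (n : ℕ) (x : Fin n → X) (y : Fin n → Bool) (H : Set (X → Bool)),
        H.Nonempty → ActiveLearning.vcDim H ≠ ⊤ →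
      ∀ tie : Finset (Fin n → Bool) → (Fin n → Bool), (∀ A, A.Nonempty → tie A ∈ A) →
      ∀ ε δ : ℝ, 0 < ε → ε ≤ 1 → 0 < δ → δ < 1 →
      ∀ T : ℕ, Real.logb 2 (2 * n) ≤ T →
        ENNReal.ofReal (1 - δ) ≤
          (ActiveLearning.algorithm c₁ c₂ b₁ b₂ ε δ x y H tie T).toOuterMeasure
            {o | ∃ h ∈ H, o = some (h ∘ x) ∧
              (ActiveLearning.err y Finset.univ (h ∘ x) <
                  ActiveLearning.optimalError x y H * (1 + ε) ∨
                ActiveLearning.err y Finset.univ (h ∘ x) = 0 ∧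
                  ActiveLearning.optimalError x y H = 0)} := by
  have hc : 0 < ActiveLearning.sampleConst := by norm_num [ActiveLearning.sampleConst]
  refine ⟨_, _, _, _, hc, hc, hc, hc, ?_⟩
  intro X n x y H hne hH tie htie ε δ hε hε1 hδ hδ1 T hT
  obtain ⟨g, hg, hgopt, hmin⟩ := ActiveLearning.exists_optimal x y hne
  have hfail := ActiveLearning.algorithm_failure_le hH htie hε hε1 hδ hδ1 hT hg hmin
  rw [hgopt] at hfail
  set p := ActiveLearning.algorithm ActiveLearning.sampleConst ActiveLearning.sampleConst
    ActiveLearning.sampleConst ActiveLearning.sampleConst ε δ x y H tie T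
  set s := ActiveLearning.nearOptimal y (ActiveLearning.onData x H)
    (ActiveLearning.optimalError x y H) ε with hs
  have hsub : s ⊆ {o | ∃ h ∈ H, o = some (h ∘ x) ∧
      (ActiveLearning.err y Finset.univ (h ∘ x) < ActiveLearning.optimalError x y H * (1 + ε) ∨
        ActiveLearning.err y Finset.univ (h ∘ x) = 0 ∧
          ActiveLearning.optimalError x y H = 0)} := by
    rintro o ⟨k, hk, rfl, hgood⟩
    obtain ⟨h, hh, rfl⟩ := ActiveLearning.mem_onData.1 hk
    exact ⟨h, hh, rfl, hgood⟩
  refine le_trans ?_ (MeasureTheory.measure_mono hsub)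
  have hone : 1 ≤ p.toOuterMeasure s + p.toOuterMeasure sᶜ := by
    refine le_trans ?_ (MeasureTheory.measure_union_le s sᶜ)
    rw [Set.union_compl_self, (p.toOuterMeasure_apply_eq_one_iff _).2 (Set.subset_univ _)]
  rw [ENNReal.ofReal_sub _ hδ.le, ENNReal.ofReal_one, tsub_le_iff_right]
  exact hone.trans (by gcongr)
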